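/- Let $F$ be an algebraically closed field of characteristic $p>3$ and let $n\ge 2$. Let $\mathfrak g=\mathfrak p(n)$ be the Lie superalgebra over $F$ of all block matrices $\begin{pmatrix} a& b\\ c&-a^t\end{pmatrix}$ with $a,b,c\in M_n(F)$, $b$ symmetric and $c$ skew-symmetric, with the supercommutator as bracket; $\mathfrak g_{\bar 0}$ is given by $b=c=0$, $\mathfrak g_{\bar 1}$ by $a=0$, and $\mathfrak g_1$ by $a=c=0$. It is restricted, with $x^{[p]}$ the $p$-th matrix power for $x\in\mathfrak g_{\bar 0}$. Let $u(\mathfrak g)$ be its restricted enveloping superalgebra, let $d=\tfrac12 n(n-1)$, let $I$ be the two-sided ideal of $u(\mathfrak g)$ generated by all products of $k$ elements of $\mathfrak g_1$ with $k>d$, and let $\bar{\mathfrak u}=u(\mathfrak g)/I$. The group $G=GL_n(F)$ acts on $\mathfrak g$ by $x\mapsto\rho(g)x\rho(g)^{-1}$, $\rho(g)=\mathrm{diag}(g,(g^{-1})^{t})$, and hence on $\bar{\mathfrak u}$ by algebra automorphisms. Let $T\subset G$ be the torus of diagonal matrices, $\bar{\mathfrak u}^T$ the space of $T$-invariants, and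 $$\mathcal Z=\{u\in\bar{\mathfrak u}_{\bar 0}\mid gu=u \text{ for all } g\in G,\ [u,\mathfrak g_1]=0\}\subseteq\bar{\mathfrak u}^T .$$ Let $\mathfrak h\subset\mathfrak g_{\bar 0}$ be the diagonal matrices, with basis $h_i=e_{ii}-e_{n+i,n+i}$ and dual basis $\epsilon_i$ of $\mathfrak h^*$ ($1\le i\le n$), and let $u(\mathfrak h)=U(\mathfrak h)/(x^p-x^{[p]}: x\in\mathfrak h)$ be its restricted enveloping algebra. Let $\mathfrak n^+$ be the span of $\mathfrak g_1$ and of the $e_{ij}-e_{n+j,n+i}$ with $1\le i<j\le n$, let $\bar{\mathfrak u}\mathfrak n^+$ be the left ideal of $\bar{\mathfrak u}$ generated by $\mathfrak n^+$, and let $\mathfrak l=\bar{\mathfrak u}\mathfrak n^+\cap\bar{\mathfrak u}^T$. The Harish-Chandra map is the $F$-linear map $h:\bar{\mathfrak u}^T\to u(\mathfrak h)$ that has kernel $\mathfrak l$ and restricts to the identity on $u(\mathfrak h)$ (that is, composed with the canonical map $u(\mathfrak h)\to\bar{\mathfrak u}^T$ it gives the identity of $u(\mathfrak h)$). Let $W=S_n$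 be the Weyl group, acting on $\mathfrak h^*$ by $w\epsilon_i=\epsilon_{w(i)}$, let $\rho\in\mathfrak h^*$ satisfy $\rho(h_i-h_{i+1})=1$ for $1\le i<n$, and let $w\cdot\lambda=w(\lambda+\rho)-\rho$ be the dot action on $\mathfrak h^*$. It induces the dot action on $U(\mathfrak h)$, viewed as the algebra of polynomial functions on $\mathfrak h^*$, by $(w\cdot f)(\lambda)=f(w^{-1}\cdot\lambda)$, and this descends to $u(\mathfrak h)$. Let $u(\mathfrak h)^{W\cdot}$ be the set of invariants. Then the map $h$ exists and is unique, and $$h(\mathcal Z)\subseteq u(\mathfrak h)^{W\cdot}.$$ -/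

import Mathlib

open Matrix

set_option linter.unusedSectionVars false

noncomputable section

namespace Periplectic

/-! ### The Lie superalgebra p(n) -/

/-- Square matrices of size 2n, written in n × n blocks. -/
abbrev Mat (n : ℕ) (F : Type*) := Matrix (Fin n ⊕ Fin n) (Fin n ⊕ Fin n) F

section LieSuper

variable (n : ℕ) (F : Type*) [Field F]

/-- The space underlying p(n): all block matrices (a, b; c, -aᵗ) with b symmetric and
c skew-symmetric. -/
def pn : Submodule F (Mat n F) where
  carrier := {x | ∃ a b c : Matrix (Fin n) (Fin n) F,
    bᵀ = b ∧ cᵀ = -c ∧ x = fromBlocks a b c (-aᵀ)}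
  zero_mem' := ⟨0, 0, 0, by simp, by simp, by simp⟩
  add_mem' := by
    rintro _ _ ⟨a, b, c, hb, hc, rfl⟩ ⟨a', b', c', hb', hc', rfl⟩
    refine ⟨a + a', b + b', c + c', by simp [hb, hb'], by simp [hc, hc', add_comm], ?_⟩
    simp [fromBlocks_add, add_comm]
  smul_mem' := by
    rintro r _ ⟨a, b, c, hb, hc, rfl⟩
    exact ⟨r • a, r • b, r • c, by simp [hb], by simp [hc], by simp [fromBlocks_smul]⟩

variable {n F}

/-- The ℤ/2-grading of p(n): degree 0 consists of the elements with b = c = 0 and degree 1 of the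
elements with a = 0. -/
def HasParity (i : ZMod 2) (x : pn n F) : Prop :=
  if i = 0 then (x : Mat n F).toBlocks₁₂ = 0 ∧ (x : Mat n F).toBlocks₂₁ = 0
  else (x : Mat n F).toBlocks₁₁ = 0

/-- The component of ℤ-degree 1, where a = c = 0. -/
def IsDegOne (x : pn n F) : Prop :=
  (x : Mat n F).toBlocks₁₁ = 0 ∧ (x : Mat n F).toBlocks₂₁ = 0

/-- The nilradical spanned by the root vectors of the roots εᵢ - εⱼ, i < j, of the even part:
b = c = 0 and a is strictly upper triangular. -/
def IsEvenPos (x : pn n F) : Prop :=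
  HasParity 0 x ∧ ∀ i j : Fin n, j ≤ i → (x : Mat n F).toBlocks₁₁ i j = 0

/-- The off-diagonal (odd) part of a block matrix. -/
def oddPart (x : Mat n F) : Mat n F := fromBlocks 0 x.toBlocks₁₂ x.toBlocks₂₁ 0

/-- The supercommutator of block matrices: the bilinear map which is
xy - (-1)^(|x||y|) yx on homogeneous x, y. -/
def superComm (x y : Mat n F) : Mat n F :=
  x * y - y * x + (2 : F) • (oddPart y * oddPart x)

theorem superComm_mem {x y : Mat n F} (hx : x ∈ pn n F) (hy : y ∈ pn n F) :
    superComm x y ∈ pn n F := by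
  obtain ⟨a, b, c, hb, hc, rfl⟩ := hx
  obtain ⟨a', b', c', hb', hc', rfl⟩ := hy
  refine ⟨a * a' - a' * a + b * c' + b' * c, a * b' - b * a'ᵀ - a' * b + b' * aᵀ,
    c * a' - aᵀ * c' - c' * a + a'ᵀ * c, ?_, ?_, ?_⟩
  · simp [transpose_mul, hb, hb']; abel
  · simp [transpose_mul, hc, hc']; abel
  · simp only [superComm, oddPart, toBlocks_fromBlocks₁₂, toBlocks_fromBlocks₂₁,
      fromBlocks_multiply, sub_eq_add_neg, fromBlocks_neg, fromBlocks_add, fromBlocks_smul,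
      transpose_add, transpose_neg, transpose_mul, hb, hb', hc, hc']
    congr 1 <;> simp [two_smul] <;> abel

/-- The superbracket of p(n). -/
def bracket (x y : pn n F) : pn n F := ⟨superComm x.1 y.1, superComm_mem x.2 y.2⟩

/-- The sign (-1)^(ij). -/
def koszul (F : Type*) [Field F] (i j : ZMod 2) : F := if i = 1 ∧ j = 1 then -1 else 1

/-- On homogeneous elements the bracket is the supercommutator of matrices. -/
theorem bracket_coe {i j : ZMod 2} {x y : pn n F} (hx : HasParity i x) (hy : HasParity j y) :
    (bracket x y : Mat n F) = (x : Mat n F) * y - koszul F i j • ((y : Mat n F) * x) := by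
  obtain ⟨x, a, b, c, hb, hc, rfl⟩ := x
  obtain ⟨y, a', b', c', hb', hc', rfl⟩ := y
  have h2 : ∀ k : ZMod 2, k = 0 ∨ k = 1 := by decide
  rcases h2 i with rfl | rfl <;> rcases h2 j with rfl | rfl <;>
    simp_all [HasParity, bracket, superComm, oddPart, koszul, fromBlocks_multiply,
      sub_eq_add_neg, fromBlocks_neg, fromBlocks_add, two_smul]

theorem even_eq {x : pn n F} (hx : HasParity 0 x) :
    ∃ a : Matrix (Fin n) (Fin n) F, (x : Mat n F) = fromBlocks a 0 0 (-aᵀ) := by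
  obtain ⟨x, a, b, c, hb, hc, rfl⟩ := x
  simp only [HasParity, if_true, toBlocks_fromBlocks₁₂, toBlocks_fromBlocks₂₁] at hx
  exact ⟨a, by simp [hx.1, hx.2]⟩

theorem fromBlocks_diag_pow (a d : Matrix (Fin n) (Fin n) F) (k : ℕ) :
    (fromBlocks a 0 0 d : Mat n F) ^ k = fromBlocks (a ^ k) 0 0 (d ^ k) := by
  induction k with
  | zero => simp
  | succ k ih => simp [pow_succ, ih, fromBlocks_multiply]

variable (p : ℕ) [Fact p.Prime] [CharP F p]

theorem pow_mem {x : pn n F} (hx : HasParity 0 x) : (x : Mat n F) ^ p ∈ pn n F := by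
  obtain ⟨a, ha⟩ := even_eq hx
  refine ⟨a ^ p, 0, 0, by simp, by simp, ?_⟩
  rw [ha, fromBlocks_diag_pow]
  have h1 : ((-1 : F)) ^ p = -1 := neg_one_pow_char F p
  have h2 : (-aᵀ) = (-1 : F) • aᵀ := by simp
  rw [h2, smul_pow, h1, transpose_pow]
  simp

/-- The p-map of the even part: the p-th power of matrices. -/
def pMap (x : pn n F) (hx : HasParity 0 x) : pn n F := ⟨(x : Mat n F) ^ p, pow_mem p hx⟩

end LieSuper

/-! ### The restricted enveloping superalgebra and its quotient -/

section Enveloping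

variable (F : Type*) [Field F] (p : ℕ) [Fact p.Prime] [CharP F p] (n : ℕ)

/-- The defining relations of u(p(n)), inside the tensor algebra of p(n). -/
inductive URel : TensorAlgebra F (pn n F) → TensorAlgebra F (pn n F) → Prop
  | bracket (i j : ZMod 2) (x y : pn n F) (hx : HasParity i x) (hy : HasParity j y) :
      URel (TensorAlgebra.ι F x * TensorAlgebra.ι F y
          - koszul F i j • (TensorAlgebra.ι F y * TensorAlgebra.ι F x))
        (TensorAlgebra.ι F (bracket x y))
  | pPower (x : pn n F) (hx : HasParity 0 x) :
      URel (TensorAlgebra.ι F x ^ p) (TensorAlgebra.ι F (pMap p x hx))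

/-- The restricted enveloping superalgebra u(p(n)). -/
def U := RingQuot (URel F p n)

instance : Ring (U F p n) := inferInstanceAs (Ring (RingQuot (URel F p n)))
instance : Algebra F (U F p n) := inferInstanceAs (Algebra F (RingQuot (URel F p n)))

/-- The canonical map from p(n) to u(p(n)). -/
def ιU : pn n F →ₗ[F] U F p n :=
  (RingQuot.mkAlgHom F (URel F p n)).toLinearMap ∘ₗ TensorAlgebra.ι F

/-- The generators of the ideal I, that is, all products of k elements of degree 1
with k > n(n-1)/2, set equal to 0. -/
inductive IRel : U F p n → U F p n → Prop
  | mk (l : List (pn n F)) (hl : ∀ x ∈ l, IsDegOne x) (hk : n * (n - 1) / 2 < l.length) :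
      IRel (l.map (ιU F p n)).prod 0

/-- The quotient algebra ū = u(p(n)) / I. -/
def Ubar := RingQuot (IRel F p n)

instance : Ring (Ubar F p n) := inferInstanceAs (Ring (RingQuot (IRel F p n)))
instance : Algebra F (Ubar F p n) := inferInstanceAs (Algebra F (RingQuot (IRel F p n)))

/-- The projection of u(p(n)) onto ū. -/
def toUbar : U F p n →ₐ[F] Ubar F p n := RingQuot.mkAlgHom F (IRel F p n)

/-- The canonical map from p(n) to ū. -/
def ι : pn n F →ₗ[F] Ubar F p n := (toUbar F p n).toLinearMap ∘ₗ ιU F p n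

/-- The even part of ū: the span of all products of homogeneous elements of p(n) whose parities
add up to 0. -/
def evenUbar : Submodule F (Ubar F p n) :=
  Submodule.span F {u | ∃ l : List (ZMod 2 × pn n F), (∀ a ∈ l, HasParity a.1 a.2) ∧
    (l.map Prod.fst).sum = 0 ∧ u = (l.map fun a => ι F p n a.2).prod}

variable {F p n}

theorem ιU_bracket {i j : ZMod 2} {x y : pn n F} (hx : HasParity i x) (hy : HasParity j y) :
    ιU F p n x * ιU F p n y - koszul F i j • (ιU F p n y * ιU F p n x)
      = ιU F p n (bracket x y) := by
  have h := RingQuot.mkAlgHom_rel F (URel.bracket (p := p) i j x y hx hy)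
  rw [map_sub, map_smul, map_mul, map_mul] at h
  exact h

theorem ιU_pPower {x : pn n F} (hx : HasParity 0 x) :
    ιU F p n x ^ p = ιU F p n (pMap p x hx) := by
  have h := RingQuot.mkAlgHom_rel F (URel.pPower (p := p) x hx)
  rw [map_pow] at h
  exact h

theorem toUbar_prod (l : List (pn n F)) (hl : ∀ x ∈ l, IsDegOne x)
    (hk : n * (n - 1) / 2 < l.length) : toUbar F p n (l.map (ιU F p n)).prod = 0 := by
  have h := RingQuot.mkAlgHom_rel F (IRel.mk (p := p) l hl hk)
  rw [map_zero] at h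
  exact h

end Enveloping

/-! ### The action of GL(n) -/

section GroupAction

variable {F : Type*} [Field F] {n : ℕ}

/-- The embedding g ↦ diag(g, g⁻¹ᵗ) of GL(n) into invertible matrices of size 2n. -/
def rho (g : GL (Fin n) F) : Mat n F :=
  fromBlocks (g : Matrix (Fin n) (Fin n) F) 0 0 (((g⁻¹ : GL (Fin n) F) : Matrix _ _ F)ᵀ)

theorem rho_mul_inv (g : GL (Fin n) F) : rho g * rho g⁻¹ = 1 := by
  simp only [rho, fromBlocks_multiply, ← transpose_mul, inv_inv, ← Units.val_mul]
  simp

theorem rho_inv_mul (g : GL (Fin n) F) : rho g⁻¹ * rho g = 1 := by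
  simpa using rho_mul_inv g⁻¹

/-- The blocks of the conjugate of a block matrix. -/
theorem conj_fromBlocks (g : GL (Fin n) F) (a b c d : Matrix (Fin n) (Fin n) F) :
    rho g * fromBlocks a b c d * rho g⁻¹ =
      fromBlocks (g.1 * a * (g⁻¹).1) (g.1 * b * g.1ᵀ)
        ((g⁻¹).1ᵀ * c * (g⁻¹).1) ((g⁻¹).1ᵀ * d * g.1ᵀ) := by
  simp [rho, fromBlocks_multiply, Matrix.mul_assoc]

theorem conj_mem (g : GL (Fin n) F) {x : Mat n F} (hx : x ∈ pn n F) :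
    rho g * x * rho g⁻¹ ∈ pn n F := by
  obtain ⟨a, b, c, hb, hc, rfl⟩ := hx
  rw [conj_fromBlocks]
  refine ⟨_, _, _, ?_, ?_, congrArg _ ?_⟩
  · simp [transpose_mul, hb, Matrix.mul_assoc]
  · simp [transpose_mul, hc, Matrix.mul_assoc]
  · simp [transpose_mul, Matrix.mul_assoc]

/-- The adjoint action x ↦ ρ(g) x ρ(g)⁻¹ of GL(n) on p(n). -/
def Ad (g : GL (Fin n) F) : pn n F →ₗ[F] pn n F where
  toFun x := ⟨rho g * x * rho g⁻¹, conj_mem g x.2⟩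
  map_add' x y := by ext1; simp [Matrix.mul_add, Matrix.add_mul]
  map_smul' r x := by ext1; simp

theorem Ad_blocks (g : GL (Fin n) F) (x : pn n F) :
    (Ad g x : Mat n F) =
      fromBlocks (g.1 * x.1.toBlocks₁₁ * (g⁻¹).1) (g.1 * x.1.toBlocks₁₂ * g.1ᵀ)
        ((g⁻¹).1ᵀ * x.1.toBlocks₂₁ * (g⁻¹).1) ((g⁻¹).1ᵀ * x.1.toBlocks₂₂ * g.1ᵀ) := by
  rw [← conj_fromBlocks, fromBlocks_toBlocks]; rfl

theorem Ad_parity (g : GL (Fin n) F) {i : ZMod 2} {x : pn n F} (hx : HasParity i x) :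
    HasParity i (Ad g x) := by
  unfold HasParity at hx ⊢
  rw [Ad_blocks]
  split_ifs at hx ⊢ <;> simp [hx]

theorem Ad_degOne (g : GL (Fin n) F) {x : pn n F} (hx : IsDegOne x) : IsDegOne (Ad g x) := by
  unfold IsDegOne at hx ⊢
  rw [Ad_blocks]
  simp [hx]

theorem Ad_mul_coe (g : GL (Fin n) F) (x y : Mat n F) :
    (rho g * x * rho g⁻¹) * (rho g * y * rho g⁻¹) = rho g * (x * y) * rho g⁻¹ := by
  calc _ = rho g * x * (rho g⁻¹ * rho g) * y * rho g⁻¹ := by simp only [Matrix.mul_assoc]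
    _ = _ := by rw [rho_inv_mul]; simp only [Matrix.mul_assoc, Matrix.mul_one]

theorem Ad_bracket (g : GL (Fin n) F) {i j : ZMod 2} {x y : pn n F} (hx : HasParity i x)
    (hy : HasParity j y) : Ad g (bracket x y) = bracket (Ad g x) (Ad g y) := by
  ext1
  rw [bracket_coe (Ad_parity g hx) (Ad_parity g hy)]
  change rho g * (bracket x y : Mat n F) * rho g⁻¹ = (rho g * x * rho g⁻¹) * (rho g * y * rho g⁻¹)
    - koszul F i j • ((rho g * y * rho g⁻¹) * (rho g * x * rho g⁻¹))
  rw [bracket_coe hx hy, Ad_mul_coe, Ad_mul_coe]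
  simp [Matrix.mul_sub, Matrix.sub_mul]

variable (p : ℕ) [Fact p.Prime] [CharP F p]

theorem Ad_pMap (g : GL (Fin n) F) {x : pn n F} (hx : HasParity 0 x) :
    Ad g (pMap p x hx) = pMap p (Ad g x) (Ad_parity g hx) := by
  ext1
  change rho g * (x : Mat n F) ^ p * rho g⁻¹ = (rho g * (x : Mat n F) * rho g⁻¹) ^ p
  have key : ∀ k : ℕ, (rho g * (x : Mat n F) * rho g⁻¹) ^ k
      = rho g * (x : Mat n F) ^ k * rho g⁻¹ := by
    intro k
    induction k with
    | zero => simp [rho_mul_inv]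
    | succ k ih => rw [pow_succ, ih, Ad_mul_coe, pow_succ]
  exact (key p).symm

/-- The action of g on u(p(n)) by the algebra endomorphism that extends the adjoint action. -/
def actU (g : GL (Fin n) F) : U F p n →ₐ[F] U F p n :=
  RingQuot.liftAlgHom F ⟨TensorAlgebra.lift F (ιU F p n ∘ₗ Ad g), by
    intro a b h
    cases h with
    | bracket i j x y hx hy =>
      simp only [map_sub, map_mul, map_smul, TensorAlgebra.lift_ι_apply, LinearMap.comp_apply]
      rw [Ad_bracket g hx hy]
      exact ιU_bracket (Ad_parity g hx) (Ad_parity g hy)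
    | pPower x hx =>
      simp only [map_pow, TensorAlgebra.lift_ι_apply, LinearMap.comp_apply]
      rw [Ad_pMap p g hx]
      exact ιU_pPower (Ad_parity g hx)⟩

theorem actU_ιU (g : GL (Fin n) F) (x : pn n F) :
    actU p g (ιU F p n x) = ιU F p n (Ad g x) := by
  have h := RingQuot.liftAlgHom_mkAlgHom_apply F (s := URel F p n)
    (TensorAlgebra.lift F (ιU F p n ∘ₗ Ad g)) (by
      intro a b h
      cases h with
      | bracket i j x y hx hy =>
        simp only [map_sub, map_mul, map_smul, TensorAlgebra.lift_ι_apply, LinearMap.comp_apply]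
        rw [Ad_bracket g hx hy]
        exact ιU_bracket (Ad_parity g hx) (Ad_parity g hy)
      | pPower x hx =>
        simp only [map_pow, TensorAlgebra.lift_ι_apply, LinearMap.comp_apply]
        rw [Ad_pMap p g hx]
        exact ιU_pPower (Ad_parity g hx)) (TensorAlgebra.ι F x)
  rw [TensorAlgebra.lift_ι_apply] at h
  exact h

theorem actU_IRel (g : GL (Fin n) F) {a b : U F p n} (h : IRel F p n a b) :
    ((toUbar F p n).comp (actU p g)) a = ((toUbar F p n).comp (actU p g)) b := by
  cases h with
  | mk l hl hk =>
    have e : actU p g (l.map (ιU F p n)).prod = ((l.map (Ad g)).map (ιU F p n)).prod := by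
      rw [map_list_prod, List.map_map, List.map_map]
      congr 1
      exact List.map_congr_left fun x _ => actU_ιU p g x
    rw [map_zero, AlgHom.comp_apply, e]
    refine toUbar_prod _ ?_ (by simpa using hk)
    intro x hx
    obtain ⟨y, hy, rfl⟩ := List.mem_map.1 hx
    exact Ad_degOne g (hl y hy)

/-- The induced action of g on ū. -/
def act (g : GL (Fin n) F) : Ubar F p n →ₐ[F] Ubar F p n :=
  RingQuot.liftAlgHom F ⟨(toUbar F p n).comp (actU p g), fun _ _ h => actU_IRel p g h⟩

theorem act_ι (g : GL (Fin n) F) (x : pn n F) : act p g (ι F p n x) = ι F p n (Ad g x) := by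
  have h := RingQuot.liftAlgHom_mkAlgHom_apply F (s := IRel F p n)
    ((toUbar F p n).comp (actU p g)) (fun _ _ h => actU_IRel p g h) (ιU F p n x)
  rw [AlgHom.comp_apply, actU_ιU] at h
  exact h

variable (F n)

/-- The algebra 𝒵: even elements of ū that are fixed by GL(n) and (super)commute with the
elements of degree 1. The supercommutator with an even element is the ordinary one. -/
def centralZ : Set (Ubar F p n) :=
  {u | u ∈ evenUbar F p n ∧ (∀ g : GL (Fin n) F, act p g u = u) ∧
    ∀ x : pn n F, IsDegOne x → u * ι F p n x - ι F p n x * u = 0}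

/-- The invariants ūᵀ of the torus T of diagonal matrices in GL(n). -/
def torusInv : Submodule F (Ubar F p n) where
  carrier := {u | ∀ t : GL (Fin n) F, (t : Matrix (Fin n) (Fin n) F).IsDiag → act p t u = u}
  zero_mem' := by simp
  add_mem' := by
    intro a b ha hb t ht
    rw [map_add, ha t ht, hb t ht]
  smul_mem' := by
    intro r a ha t ht
    rw [map_smul, ha t ht]

/-- The left ideal ū𝔫⁺ generated by the positive root vectors of p(n). -/
def leftIdealPos : Ideal (Ubar F p n) :=
  Ideal.span {u | ∃ x : pn n F, (IsEvenPos x ∨ IsDegOne x) ∧ u = ι F p n x}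

/-- The space 𝔩 = ū𝔫⁺ ∩ ūᵀ, as a subspace of ūᵀ. -/
def lSub : Submodule F (torusInv F n p) :=
  ((leftIdealPos F n p).restrictScalars F).comap (torusInv F n p).subtype

end GroupAction

/-! ### The restricted enveloping algebra of the Cartan subalgebra, and the dot action -/

section Cartan

variable (F : Type*) [Field F] (p : ℕ) [Fact p.Prime] [CharP F p] (n : ℕ)

/-- The defining relations of u(𝔥). The maximal torus 𝔥 is described by coordinates in its basis
h₁, …, hₙ; it is abelian and its p-map is the coordinatewise p-th power. -/
inductive HRel : TensorAlgebra F (Fin n → F) → TensorAlgebra F (Fin n → F) → Prop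
  | comm (x y : Fin n → F) :
      HRel (TensorAlgebra.ι F x * TensorAlgebra.ι F y) (TensorAlgebra.ι F y * TensorAlgebra.ι F x)
  | pPower (x : Fin n → F) : HRel (TensorAlgebra.ι F x ^ p) (TensorAlgebra.ι F (x ^ p))

/-- The restricted enveloping algebra u(𝔥). -/
def Uh := RingQuot (HRel F p n)

instance : Ring (Uh F p n) := inferInstanceAs (Ring (RingQuot (HRel F p n)))
instance : Algebra F (Uh F p n) := inferInstanceAs (Algebra F (RingQuot (HRel F p n)))

/-- The canonical map from 𝔥 to u(𝔥). -/
def ιh : (Fin n → F) →ₗ[F] Uh F p n :=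
  (RingQuot.mkAlgHom F (HRel F p n)).toLinearMap ∘ₗ TensorAlgebra.ι F

variable {F n}

/-- The diagonal matrix diag(x, -x), that is, ∑ xᵢ hᵢ, as an element of p(n). -/
def cartanElt : (Fin n → F) →ₗ[F] pn n F where
  toFun x := ⟨fromBlocks (diagonal x) 0 0 (-(diagonal x)ᵀ),
    ⟨diagonal x, 0, 0, by simp, by simp, rfl⟩⟩
  map_add' x y := by
    ext1
    change fromBlocks (diagonal (x + y)) 0 0 (-(diagonal (x + y))ᵀ)
      = (fromBlocks (diagonal x) 0 0 (-(diagonal x)ᵀ) : Mat n F)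
        + fromBlocks (diagonal y) 0 0 (-(diagonal y)ᵀ)
    rw [fromBlocks_add, show diagonal (x + y) = diagonal x + diagonal y from (diagonal_add x y).symm, transpose_add, neg_add]
    simp only [add_zero]
  map_smul' r x := by
    ext1
    change fromBlocks (diagonal (r • x)) 0 0 (-(diagonal (r • x))ᵀ)
      = r • (fromBlocks (diagonal x) 0 0 (-(diagonal x)ᵀ) : Mat n F)
    rw [fromBlocks_smul, diagonal_smul, transpose_smul, smul_neg, smul_zero]

theorem cartanElt_parity (x : Fin n → F) : HasParity 0 (cartanElt x) := by
  simp [HasParity, cartanElt]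

theorem ιh_comm (x y : Fin n → F) : ιh F p n x * ιh F p n y = ιh F p n y * ιh F p n x := by
  have h := RingQuot.mkAlgHom_rel F (HRel.comm (p := p) x y)
  rw [map_mul, map_mul] at h
  exact h

theorem ιh_pPower (x : Fin n → F) : ιh F p n x ^ p = ιh F p n (x ^ p) := by
  have h := RingQuot.mkAlgHom_rel F (HRel.pPower (p := p) x)
  rw [map_pow] at h
  exact h

/-- The algebra homomorphism from u(𝔥) defined by a linear map on 𝔥 that respects the relations. -/
def liftUh {A : Type*} [Ring A] [Algebra F A] (f : (Fin n → F) →ₗ[F] A)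
    (hc : ∀ x y, f x * f y = f y * f x) (hp : ∀ x, f x ^ p = f (x ^ p)) : Uh F p n →ₐ[F] A :=
  RingQuot.liftAlgHom F ⟨TensorAlgebra.lift F f, by
    intro a b h
    cases h with
    | comm x y => simpa using hc x y
    | pPower x => simpa using hp x⟩

theorem liftUh_ιh {A : Type*} [Ring A] [Algebra F A] (f : (Fin n → F) →ₗ[F] A)
    (hc : ∀ x y, f x * f y = f y * f x) (hp : ∀ x, f x ^ p = f (x ^ p)) (x : Fin n → F) :
    liftUh p f hc hp (ιh F p n x) = f x := by
  have h := RingQuot.liftAlgHom_mkAlgHom_apply F (s := HRel F p n) (TensorAlgebra.lift F f) (by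
    intro a b h
    cases h with
    | comm x y => simpa using hc x y
    | pPower x => simpa using hp x) (TensorAlgebra.ι F x)
  rw [TensorAlgebra.lift_ι_apply] at h
  exact h

theorem uh_hom_ext {A : Type*} [Ring A] [Algebra F A] {f g : Uh F p n →ₐ[F] A}
    (h : ∀ x, f (ιh F p n x) = g (ιh F p n x)) : f = g := by
  refine RingQuot.ringQuot_ext' F f g ?_
  refine TensorAlgebra.hom_ext (LinearMap.ext fun x => ?_)
  exact h x

theorem ι_cartan_comm (x y : Fin n → F) :
    ι F p n (cartanElt x) * ι F p n (cartanElt y)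
      = ι F p n (cartanElt y) * ι F p n (cartanElt x) := by
  have h := ιU_bracket (p := p) (cartanElt_parity x) (cartanElt_parity y)
  have hb : bracket (cartanElt x) (cartanElt y) = 0 := by
    ext1
    rw [bracket_coe (cartanElt_parity x) (cartanElt_parity y)]
    change (fromBlocks (diagonal x) 0 0 (-(diagonal x)ᵀ) : Mat n F)
        * fromBlocks (diagonal y) 0 0 (-(diagonal y)ᵀ)
        - koszul F 0 0 • (fromBlocks (diagonal y) 0 0 (-(diagonal y)ᵀ)
          * fromBlocks (diagonal x) 0 0 (-(diagonal x)ᵀ)) = 0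
    simp only [koszul, zero_ne_one, and_self, if_false, one_smul, fromBlocks_multiply,
      Matrix.mul_zero, Matrix.zero_mul, add_zero, zero_add, diagonal_transpose,
      neg_mul_neg, diagonal_mul_diagonal, mul_comm, sub_self]
  rw [hb, map_zero] at h
  have h' := congrArg (toUbar F p n) h
  simp only [koszul, zero_ne_one, and_self, if_false, one_smul, map_sub, map_mul, map_zero] at h'
  exact sub_eq_zero.1 h'

theorem ι_cartan_pow (x : Fin n → F) :
    ι F p n (cartanElt x) ^ p = ι F p n (cartanElt (x ^ p)) := by
  have h := ιU_pPower (p := p) (cartanElt_parity x)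
  have hb : pMap p (cartanElt x) (cartanElt_parity x) = cartanElt (x ^ p) := by
    ext1
    change (fromBlocks (diagonal x) 0 0 (-(diagonal x)ᵀ) : Mat n F) ^ p
      = fromBlocks (diagonal (x ^ p)) 0 0 (-(diagonal (x ^ p))ᵀ)
    have h1 : ((-1 : F)) ^ p = -1 := neg_one_pow_char F p
    have h2 : (-(diagonal x)ᵀ) = (-1 : F) • diagonal x := by simp
    rw [fromBlocks_diag_pow, h2, smul_pow, h1, diagonal_pow]
    simp
  rw [hb] at h
  have h' := congrArg (toUbar F p n) h
  rw [map_pow] at h'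
  exact h'

variable (F n)

/-- The canonical map from u(𝔥) to ū. -/
def cartanMap : Uh F p n →ₐ[F] Ubar F p n :=
  liftUh p (ι F p n ∘ₗ cartanElt) (ι_cartan_comm p) (ι_cartan_pow p)

theorem cartanMap_mem (f : Uh F p n) : cartanMap F p n f ∈ torusInv F n p := by
  intro t ht
  suffices h : (act p t).comp (cartanMap F p n) = cartanMap F p n from DFunLike.congr_fun h f
  refine uh_hom_ext p fun x => ?_
  rw [AlgHom.comp_apply, cartanMap, liftUh_ιh, LinearMap.comp_apply, act_ι]
  congr 1
  ext1
  rw [Ad_blocks]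
  have hd : t.1 = diagonal (diag t.1) := ht.diagonal_diag.symm
  have hcm : t.1 * diagonal x = diagonal x * t.1 := by
    rw [hd]; simp [mul_comm]
  have e1 : t.1 * diagonal x * (t⁻¹).1 = diagonal x := by
    rw [hcm, Matrix.mul_assoc, ← Units.val_mul]; simp
  have e2 : (t⁻¹).1ᵀ * diagonal x * t.1ᵀ = diagonal x := by
    have h3 : t.1 * (diagonal x * (t⁻¹).1) = diagonal x := by
      rw [← Matrix.mul_assoc, e1]
    have h4 := congrArg transpose h3
    simp only [transpose_mul, diagonal_transpose] at h4
    exact h4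
  simp only [cartanElt, LinearMap.coe_mk, AddHom.coe_mk, toBlocks_fromBlocks₁₁,
    toBlocks_fromBlocks₁₂, toBlocks_fromBlocks₂₁, toBlocks_fromBlocks₂₂, e1, diagonal_transpose,
    Matrix.mul_neg, Matrix.neg_mul, e2, Matrix.mul_zero, Matrix.zero_mul]

/-- The property that pins down the Harish-Chandra homomorphism ūᵀ → u(𝔥): it is the projection of
ūᵀ onto its subspace u(𝔥) with kernel 𝔩. -/
def IsHarishChandra (h : torusInv F n p →ₗ[F] Uh F p n) : Prop :=
  (∀ f : Uh F p n, h ⟨cartanMap F p n f, cartanMap_mem F p n f⟩ = f) ∧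
    LinearMap.ker h = lSub F n p

variable {F n}

/-- A weight ρ with ρ(hᵢ - hᵢ₊₁) = 1 for all i, in coordinates with respect to ε₁, …, εₙ. -/
def rhoWeight (i : Fin n) : F := -((i : ℕ) : F)

/-- The dot action w · μ = w(μ + ρ) - ρ on 𝔥* of the Weyl group, which is the symmetric group
acting by w εᵢ = ε_{w(i)}. -/
def dotWeight (w : Equiv.Perm (Fin n)) (μ : Fin n → F) : Fin n → F :=
  fun i => (μ (w⁻¹ i) + rhoWeight (w⁻¹ i)) - rhoWeight i

/-- The dot action on an element x of 𝔥, viewed as a function on 𝔥*: the polynomial function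
w · x of degree at most one equals w(x) + x(w⁻¹ · 0). -/
def dotGen (w : Equiv.Perm (Fin n)) : (Fin n → F) →ₗ[F] Uh F p n where
  toFun x := ιh F p n (fun i => x (w⁻¹ i))
    + algebraMap F (Uh F p n) (∑ i, x i * dotWeight w⁻¹ 0 i)
  map_add' x y := by
    have : (fun i => (x + y) (w⁻¹ i)) = (fun i => x (w⁻¹ i)) + fun i => y (w⁻¹ i) := rfl
    rw [this, map_add]
    simp only [Pi.add_apply, add_mul, Finset.sum_add_distrib, map_add]
    abel
  map_smul' r x := by
    have : (fun i => (r • x) (w⁻¹ i)) = r • fun i => x (w⁻¹ i) := rfl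
    rw [this, map_smul]
    simp only [Pi.smul_apply, smul_eq_mul, mul_assoc, ← Finset.mul_sum, map_mul, mul_add,
      RingHom.id_apply, Algebra.smul_def]

/-- The function on 𝔥* given by `dotGen w x` is μ ↦ x(w⁻¹ · μ). -/
theorem dotGen_eval (w : Equiv.Perm (Fin n)) (x μ : Fin n → F) :
    ∑ i, x (w⁻¹ i) * μ i + ∑ i, x i * dotWeight w⁻¹ 0 i = ∑ i, x i * dotWeight w⁻¹ μ i := by
  rw [← Equiv.sum_comp w fun i => x (w⁻¹ i) * μ i, ← Finset.sum_add_distrib]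
  refine Finset.sum_congr rfl fun i _ => ?_
  simp [dotWeight]
  ring

theorem dotGen_comm (w : Equiv.Perm (Fin n)) (x y : Fin n → F) :
    dotGen p w x * dotGen p w y = dotGen p w y * dotGen p w x := by
  simp only [dotGen, LinearMap.coe_mk, AddHom.coe_mk]
  exact ((Commute.add_right (ιh_comm p _ _) (Algebra.commutes _ _).symm).add_left
    (Algebra.commutes _ _))

theorem dotGen_pow (w : Equiv.Perm (Fin n)) (x : Fin n → F) :
    dotGen p w x ^ p = dotGen p w (x ^ p) := by
  simp only [dotGen, LinearMap.coe_mk, AddHom.coe_mk]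
  obtain ⟨r, hr⟩ := (show Commute (ιh F p n fun i => x (w⁻¹ i))
      (algebraMap F (Uh F p n) (∑ i, x i * dotWeight w⁻¹ 0 i)) from
    (Algebra.commutes _ _).symm).exists_add_pow_prime_eq (Fact.out : p.Prime)
  have h0 : ((p : ℕ) : Uh F p n) = 0 := by
    rw [← map_natCast (algebraMap F (Uh F p n)), CharP.cast_eq_zero, map_zero]
  have hn : ∀ m : ℕ, ((m : F)) ^ p = m := fun m => by
    rw [← frobenius_def, map_natCast]
  have hd : ∀ i, dotWeight w⁻¹ (0 : Fin n → F) i ^ p = dotWeight w⁻¹ 0 i := by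
    intro i
    have : dotWeight w⁻¹ (0 : Fin n → F) i
        = ((i : ℕ) : F) - (((w⁻¹)⁻¹ i : Fin n) : ℕ) := by
      simp [dotWeight, rhoWeight]; ring
    rw [this, sub_pow_char, hn, hn]
  rw [hr, h0, zero_mul, zero_mul, zero_mul, add_zero, ιh_pPower, ← map_pow, sum_pow_char]
  simp only [mul_pow, hd]
  rfl

/-- The dot action of the Weyl group on u(𝔥), by algebra endomorphisms. -/
def dotAct (w : Equiv.Perm (Fin n)) : Uh F p n →ₐ[F] Uh F p n :=
  liftUh p (dotGen p w) (dotGen_comm p w) (dotGen_pow p w)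

variable (F n)

/-- The invariants of the dot action in u(𝔥). -/
def dotInv : Set (Uh F p n) := {f | ∀ w : Equiv.Perm (Fin n), dotAct p w f = f}

end Cartan

end Periplectic

end

noncomputable section

namespace Periplectic

/-! ### Induction principles and representations of u(p(n)) and ū -/

section Representations

variable {F : Type*} [Field F] {p : ℕ} [Fact p.Prime] [CharP F p] {n : ℕ}

/-! Both claims are tested on weights. Each hᵢ satisfies hᵢ^p = hᵢ in u(𝔥), so u(𝔥) is split
semisimple and its elements are separated by the characters of the weights with values in the prime
field (`eq_zero_of_ev_eq_zero`). What is needed is therefore, for each such weight λ, a ū-module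
with a singular vector v of weight λ, that is, v ≠ 0 and 𝔫⁺v = 0.

These modules come from tensor products with the natural module, so no PBW basis is required. Let
x₁, …, xₙ be the even basis vectors of the natural module. The component 𝔤₁ kills them, and for i ≠
j the even root vector of εᵢ - εⱼ sends a divided power monomial x^(μ) to (μᵢ + 1) x^(μ + εᵢ - εⱼ).
If μ = (p - 1, …, p - 1, r, 0, …, 0), each positive even root vector gives either the coefficient p
= 0 or a negative exponent, so x^(μ) ⊗ v is singular when v is. Starting from the trivial module,
this reaches every restricted weight (`hasSingular`). Let f be the root vector of -αᵢ, where αᵢ = εᵢ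
- εᵢ₊₁. If μᵢ = p - 1 and μᵢ₊₁ = 0, then f^j (x^(μ) ⊗ v) has leading coefficient j!, so it is
nonzero for j < p.

To pass from u(𝔤) to ū, take the span of all products of at most d elements of 𝔤₋₁ applied to the
vectors killed by 𝔤₁. Since dim 𝔤₋₁ ≤ d, this is a submodule, and 𝔤₁ lowers the length of the
products, so more than d elements of 𝔤₁ annihilate it (`exists_ubar_isSingular`).

For the existence and uniqueness of h one shows ūᵀ = u(𝔥) ⊕ 𝔩 (`isCompl_cartanMapInv`). The sum is
everything by a triangular decomposition of ū and a one-parameter torus that removes the negative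
part; it is direct because an element of u(𝔥) in ū𝔫⁺ kills singular vectors of all restricted
weights.

For the invariance of h(z), note that z acts on v by the value of h(z) at λ. Choose 0 ≤ j < p with j
= λ(hᵢ - hᵢ₊₁) + 1 in F. By the usual 𝔰𝔩₂ computation f^j v is singular of weight sᵢ · λ, and the
module can be chosen with f^j v ≠ 0. Since z is fixed by the transvections 1 + sE, it commutes with
f, so h(z) has equal values at λ and sᵢ · λ (`IsHarishChandra.apply_mem_dotInv`). -/

theorem ubar_induction {C : Ubar F p n → Prop} (scalar : ∀ r, C (algebraMap F _ r))
    (gen : ∀ x, C (ι F p n x)) (mul : ∀ a b, C a → C b → C (a * b))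
    (add : ∀ a b, C a → C b → C (a + b)) (u : Ubar F p n) : C u := by
  let π : TensorAlgebra F (pn n F) →ₐ[F] Ubar F p n :=
    (toUbar F p n).comp (RingQuot.mkAlgHom F (URel F p n))
  have hπ : Function.Surjective π := (RingQuot.mkAlgHom_surjective F (IRel F p n)).comp
    (RingQuot.mkAlgHom_surjective F (URel F p n))
  obtain ⟨u, rfl⟩ := hπ u
  induction u using TensorAlgebra.induction with
  | algebraMap r => rw [AlgHom.commutes]; exact scalar r
  | ι x => exact gen x
  | mul a b ha hb => rw [map_mul]; exact mul _ _ ha hb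
  | add a b ha hb => rw [map_add]; exact add _ _ ha hb

theorem uh_induction {C : Uh F p n → Prop} (scalar : ∀ r, C (algebraMap F _ r))
    (gen : ∀ x, C (ιh F p n x)) (mul : ∀ a b, C a → C b → C (a * b))
    (add : ∀ a b, C a → C b → C (a + b)) (u : Uh F p n) : C u := by
  obtain ⟨u, rfl⟩ := RingQuot.mkAlgHom_surjective F (HRel F p n) u
  induction u using TensorAlgebra.induction with
  | algebraMap r => rw [AlgHom.commutes]; exact scalar r
  | ι x => exact gen x
  | mul a b ha hb => rw [map_mul]; exact mul _ _ ha hb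
  | add a b ha hb => rw [map_add]; exact add _ _ ha hb

theorem ι_bracket {i j : ZMod 2} {x y : pn n F} (hx : HasParity i x) (hy : HasParity j y) :
    ι F p n x * ι F p n y - koszul F i j • (ι F p n y * ι F p n x)
      = ι F p n (bracket x y) := by
  have h := congrArg (toUbar F p n) (ιU_bracket (p := p) hx hy)
  rw [map_sub, map_smul, map_mul, map_mul] at h
  exact h

variable (p)

/-- The linear maps from p(n) to an algebra that satisfy the relations of u(p(n)). -/
structure IsRep {A : Type*} [Ring A] [Algebra F A] (φ : pn n F →ₗ[F] A) : Prop where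
  bracket : ∀ (i j : ZMod 2) (x y : pn n F), HasParity i x → HasParity j y →
    φ x * φ y - koszul F i j • (φ y * φ x) = φ (bracket x y)
  pPower : ∀ (x : pn n F) (hx : HasParity 0 x), φ x ^ p = φ (pMap p x hx)

variable {p} {A : Type*} [Ring A] [Algebra F A] {φ : pn n F →ₗ[F] A}

theorem IsRep.lift_rel (h : IsRep p φ) ⦃a b : TensorAlgebra F (pn n F)⦄ (hab : URel F p n a b) :
    TensorAlgebra.lift F φ a = TensorAlgebra.lift F φ b := by
  cases hab with
  | bracket i j x y hx hy => simpa using h.bracket i j x y hx hy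
  | pPower x hx => simpa using h.pPower x hx

/-- The extension of a representation to u(p(n)). -/
def IsRep.liftU (h : IsRep p φ) : U F p n →ₐ[F] A :=
  RingQuot.liftAlgHom F ⟨TensorAlgebra.lift F φ, h.lift_rel⟩

theorem IsRep.liftU_ιU (h : IsRep p φ) (x : pn n F) : h.liftU (ιU F p n x) = φ x := by
  have e := RingQuot.liftAlgHom_mkAlgHom_apply F (s := URel F p n)
    (TensorAlgebra.lift F φ) h.lift_rel (TensorAlgebra.ι F x)
  rw [TensorAlgebra.lift_ι_apply] at e
  exact e

theorem IsRep.liftU_rel (h : IsRep p φ) (hd : ∀ l : List (pn n F), (∀ x ∈ l, IsDegOne x) →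
    n * (n - 1) / 2 < l.length → (l.map φ).prod = 0) ⦃a b : U F p n⦄ (hab : IRel F p n a b) :
    h.liftU a = h.liftU b := by
  cases hab with
  | mk l hl hk =>
    rw [map_zero, map_list_prod, List.map_map, ← hd l hl hk]
    congr 1
    exact List.map_congr_left fun x _ => h.liftU_ιU x

/-- The extension to ū of a representation in which long products of elements of degree 1
vanish. -/
theorem IsRep.exists_lift (h : IsRep p φ) (hd : ∀ l : List (pn n F), (∀ x ∈ l, IsDegOne x) →
    n * (n - 1) / 2 < l.length → (l.map φ).prod = 0) :
    ∃ Φ : Ubar F p n →ₐ[F] A, ∀ x, Φ (ι F p n x) = φ x := by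
  refine ⟨RingQuot.liftAlgHom F ⟨h.liftU, h.liftU_rel hd⟩, fun x => ?_⟩
  have e := RingQuot.liftAlgHom_mkAlgHom_apply F (s := IRel F p n) h.liftU (h.liftU_rel hd)
    (ιU F p n x)
  rw [h.liftU_ιU] at e
  exact e

end Representations

/-! ### Characters of u(𝔥) and a criterion for dot invariance -/

section CartanCharacters

variable {F : Type*} [Field F] {p : ℕ} [Fact p.Prime] [CharP F p] {n : ℕ}

variable (p) in
/-- The weights of restricted representations: those with values in the prime field. -/
def IsRestricted (lam : Fin n → F) : Prop := ∀ i, lam i ^ p = lam i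

/-- The character of u(𝔥) defined by a restricted weight. -/
def ev (lam : Fin n → F) (hl : IsRestricted p lam) : Uh F p n →ₐ[F] F :=
  liftUh p (Fintype.linearCombination F lam) (fun _ _ => mul_comm _ _) (fun x => by
    simp only [Fintype.linearCombination_apply, smul_eq_mul, sum_pow_char, mul_pow, Pi.pow_apply]
    exact Finset.sum_congr rfl fun i _ => by rw [hl i])

theorem ev_ιh (lam : Fin n → F) (hl : IsRestricted p lam) (x : Fin n → F) :
    ev lam hl (ιh F p n x) = ∑ i, x i * lam i := by
  rw [ev, liftUh_ιh, Fintype.linearCombination_apply]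
  rfl

theorem uh_mul_comm (a b : Uh F p n) : a * b = b * a := by
  change Commute a b
  induction b using uh_induction with
  | scalar r => exact (Algebra.commutes r a).symm
  | gen y =>
    induction a using uh_induction with
    | scalar r => exact Algebra.commutes r _
    | gen x => exact ιh_comm p x y
    | mul a b ha hb => exact ha.mul_left hb
    | add a b ha hb => exact ha.add_left hb
  | mul b c hb hc => exact hb.mul_right hc
  | add b c hb hc => exact hb.add_right hc

variable (F p n) in
/-- The commutative ring structure of u(𝔥). -/
abbrev uhCommRing : CommRing (Uh F p n) :=
  { (inferInstance : Ring (Uh F p n)) with mul_comm := uh_mul_comm }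

variable (F p) in
/-- The Lagrange polynomial of a point of the prime field. -/
def lagrangePoly (c : ZMod p) : Polynomial F :=
  Lagrange.basis Finset.univ (ZMod.castHom (dvd_refl p) F) c

theorem sum_lagrangePoly : ∑ c, lagrangePoly F p c = 1 :=
  Lagrange.sum_basis ((ZMod.castHom_injective F).injOn) Finset.univ_nonempty

theorem prod_X_sub_C_castHom : ∏ c : ZMod p,
    (Polynomial.X - Polynomial.C (ZMod.castHom (dvd_refl p) F c)) =
      Polynomial.X ^ p - Polynomial.X := by
  have hp := (Fact.out : p.Prime).one_lt
  have hr : (Polynomial.X ^ p - Polynomial.X : Polynomial (ZMod p)).roots = Finset.univ.val := by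
    simpa using FiniteField.roots_X_pow_card_sub_X (ZMod p)
  have h := Polynomial.prod_multiset_X_sub_C_of_monic_of_roots_card_eq
    (p := (Polynomial.X ^ p - Polynomial.X : Polynomial (ZMod p)))
    (Polynomial.monic_X_pow_sub (by simpa using hp))
    (by rw [hr, FiniteField.X_pow_card_sub_X_natDegree_eq _ hp]; simp)
  rw [hr] at h
  have h' := congrArg (Polynomial.map (ZMod.castHom (dvd_refl p) F)) h
  rw [← Finset.prod_eq_multiset_prod, Polynomial.map_prod] at h'
  simpa using h'

/-- Multiplying the Lagrange polynomial of c by X - c gives a multiple of X^p - X, which vanishes at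
a. Thus the Lagrange polynomials at a project onto the eigenspaces of a. -/
theorem aeval_lagrangePoly {A : Type*} [CommRing A] [Algebra F A] {a : A} (ha : a ^ p = a)
    (c : ZMod p) : a * Polynomial.aeval a (lagrangePoly F p c) =
      ZMod.castHom (dvd_refl p) F c • Polynomial.aeval a (lagrangePoly F p c) := by
  have h1 : (Polynomial.X ^ p - Polynomial.X : Polynomial F) ∣
      (Polynomial.X - Polynomial.C (ZMod.castHom (dvd_refl p) F c)) * lagrangePoly F p c := by
    rw [← prod_X_sub_C_castHom, ← Finset.mul_prod_erase Finset.univ _ (Finset.mem_univ c)]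
    refine mul_dvd_mul_left _ (Finset.prod_dvd_prod_of_dvd _ _ fun i _ => ?_)
    exact Dvd.intro_left _ rfl
  have h2 := map_dvd (Polynomial.aeval a) h1
  simp only [map_sub, map_pow, Polynomial.aeval_X, ha, sub_self, zero_dvd_iff, map_mul,
    Polynomial.aeval_C] at h2
  rw [sub_mul, sub_eq_zero] at h2
  rw [h2, Algebra.smul_def]

theorem castHom_isRestricted (c : Fin n → ZMod p) :
    IsRestricted p fun i => ZMod.castHom (dvd_refl p) F (c i) := fun i => by
  rw [← map_pow, ZMod.pow_card]

/-- The products `e c` of Lagrange polynomials in the hᵢ sum to 1, and each is an eigenvector of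
u(𝔥) whose character is the evaluation at c. Hence f = ∑ f · e c is a combination of the `e c` whose
coefficients are the values of f. -/
theorem eq_zero_of_ev_eq_zero {f : Uh F p n}
    (hf : ∀ (lam : Fin n → F) (hl : IsRestricted p lam), ev lam hl f = 0) : f = 0 := by
  let _ : CommRing (Uh F p n) := uhCommRing F p n
  let b : Fin n → Uh F p n := fun i => ιh F p n (Pi.single i 1)
  have hb : ∀ i, b i ^ p = b i := fun i => by
    simp only [b, ιh_pPower]
    congr 1
    ext j
    rcases eq_or_ne j i with rfl | h
    · simp
    · simp [h, (Fact.out : p.Prime).ne_zero]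
  let e : (Fin n → ZMod p) → Uh F p n := fun c =>
    ∏ i, Polynomial.aeval (b i) (lagrangePoly F p (c i))
  have h1 : ∑ c, e c = 1 := by
    have := Finset.prod_univ_sum (fun _ : Fin n => (Finset.univ : Finset (ZMod p)))
      fun i c => Polynomial.aeval (b i) (lagrangePoly F p c)
    rw [Fintype.piFinset_univ] at this
    rw [← this]
    exact Finset.prod_eq_one fun i _ => by rw [← map_sum, sum_lagrangePoly, map_one]
  have h2 : ∀ c (g : Uh F p n), g * e c = ev _ (castHom_isRestricted c) g • e c := by
    intro c g
    induction g using uh_induction with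
    | scalar r => rw [AlgHom.commutes, ← Algebra.smul_def]; rfl
    | gen x =>
      have hx : ιh F p n x = ∑ i, x i • b i := by
        simp only [b, ← map_smul, ← map_sum]
        congr 1
        ext j
        simp [Finset.sum_apply, Pi.single_apply]
      rw [ev_ιh, hx, Finset.sum_mul, Finset.sum_smul]
      refine Finset.sum_congr rfl fun i _ => ?_
      simp only [e, ← Finset.mul_prod_erase Finset.univ _ (Finset.mem_univ i)]
      rw [smul_mul_assoc, ← mul_assoc, aeval_lagrangePoly (hb i), smul_mul_assoc, smul_smul]
    | mul a d ha hd => rw [mul_assoc, hd, mul_smul_comm, ha, map_mul, smul_smul, mul_comm]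
    | add a d ha hd => rw [add_mul, ha, hd, map_add, add_smul]
  rw [← mul_one f, ← h1, Finset.mul_sum]
  exact Finset.sum_eq_zero fun c _ => by rw [h2, hf, zero_smul]

theorem dotWeight_isRestricted (w : Equiv.Perm (Fin n)) {lam : Fin n → F}
    (hl : IsRestricted p lam) : IsRestricted p (dotWeight w lam) := by
  have hn : ∀ m : ℕ, ((m : F)) ^ p = m := fun m => by
    rw [← frobenius_def, map_natCast]
  intro i
  have : dotWeight w lam i = lam (w⁻¹ i) - ((w⁻¹ i : Fin n) : ℕ) + ((i : ℕ) : F) := by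
    simp [dotWeight, rhoWeight]; ring
  rw [this, add_pow_char, sub_pow_char, hn, hn, hl]

theorem ev_dotAct (w : Equiv.Perm (Fin n)) {lam : Fin n → F} (hl : IsRestricted p lam)
    (f : Uh F p n) :
    ev lam hl (dotAct p w f) = ev (dotWeight w⁻¹ lam) (dotWeight_isRestricted _ hl) f := by
  suffices h : (ev lam hl).comp (dotAct p w) = ev (dotWeight w⁻¹ lam) (dotWeight_isRestricted _ hl)
    from DFunLike.congr_fun h f
  refine uh_hom_ext p fun x => ?_
  rw [AlgHom.comp_apply, dotAct, liftUh_ιh, ev_ιh, ← dotGen_eval]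
  simp only [dotGen, LinearMap.coe_mk, AddHom.coe_mk, map_add, ev_ιh, AlgHom.commutes]
  rfl

theorem dotWeight_mul (w w' : Equiv.Perm (Fin n)) (lam : Fin n → F) :
    dotWeight (w * w') lam = dotWeight w (dotWeight w' lam) := by
  ext i
  simp [dotWeight]

theorem ev_congr {lam mu : Fin n → F} (hl : IsRestricted p lam) (h : lam = mu) (f : Uh F p n) :
    ev lam hl f = ev mu (h ▸ hl) f := by
  subst h; rfl

/-- An element of u(𝔥) is invariant under the dot action if its values are invariant under the
simple reflections. -/
theorem mem_dotInv {f : Uh F p n} (hf : ∀ (i : ℕ) (hi : i + 1 < n) (lam : Fin n → F)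
    (hl : IsRestricted p lam),
    ev (dotWeight (Equiv.swap ⟨i, by omega⟩ ⟨i + 1, hi⟩) lam) (dotWeight_isRestricted _ hl) f
      = ev lam hl f) : f ∈ dotInv F p n := by
  -- The generation of the symmetric group by adjacent transpositions is applied on `Fin (n + 1)`;
  -- for n = 0 there is only one weight.
  obtain _ | n := n
  · intro w
    rw [Subsingleton.elim w 1]
    refine sub_eq_zero.1 (eq_zero_of_ev_eq_zero fun lam hl => ?_)
    rw [map_sub, ev_dotAct, sub_eq_zero]
    exact ev_congr _ (Subsingleton.elim _ _) f
  have key : ∀ (w : Equiv.Perm (Fin (n + 1))) (lam : Fin (n + 1) → F) (hl : IsRestricted p lam),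
      ev (dotWeight w lam) (dotWeight_isRestricted _ hl) f = ev lam hl f := by
    intro w
    have hw : w ∈ Submonoid.closure
        (Set.range fun i : Fin n => Equiv.swap i.castSucc i.succ) := by
      rw [Equiv.Perm.mclosure_swap_castSucc_succ]; trivial
    induction hw using Submonoid.closure_induction with
    | mem w h =>
      obtain ⟨i, rfl⟩ := h
      exact fun lam hl => hf i (by omega) lam hl
    | one =>
      intro lam hl
      refine ev_congr _ ?_ f
      ext i
      simp [dotWeight]
    | mul w w' _ _ h h' =>
      intro lam hl
      rw [← h' lam hl, ← h _ (dotWeight_isRestricted w' hl)]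
      exact ev_congr _ (dotWeight_mul _ _ _) f
  intro w
  refine sub_eq_zero.1 (eq_zero_of_ev_eq_zero fun lam hl => ?_)
  rw [map_sub, ev_dotAct, sub_eq_zero]
  exact key _ _ _

end CartanCharacters

/-! ### Even elements and parities of brackets -/

section EvenElements

variable {F : Type*} [Field F] {n : ℕ}

/-- The element of the even part of p(n) defined by a square matrix. -/
def evenElt : Matrix (Fin n) (Fin n) F →ₗ[F] pn n F where
  toFun a := ⟨fromBlocks a 0 0 (-aᵀ), ⟨a, 0, 0, by simp, by simp, rfl⟩⟩
  map_add' a b := by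
    ext1
    change fromBlocks (a + b) 0 0 (-(a + b)ᵀ)
      = (fromBlocks a 0 0 (-aᵀ) : Mat n F) + fromBlocks b 0 0 (-bᵀ)
    simp [fromBlocks_add, add_comm]
  map_smul' r a := by
    ext1
    change fromBlocks (r • a) 0 0 (-(r • a)ᵀ) = r • (fromBlocks a 0 0 (-aᵀ) : Mat n F)
    simp [fromBlocks_smul]

theorem evenElt_coe (a : Matrix (Fin n) (Fin n) F) :
    (evenElt a : Mat n F) = fromBlocks a 0 0 (-aᵀ) := rfl

theorem evenElt_parity (a : Matrix (Fin n) (Fin n) F) : HasParity 0 (evenElt a) := by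
  simp [HasParity, evenElt_coe]

theorem eq_evenElt {x : pn n F} (hx : HasParity 0 x) :
    x = evenElt (x : Mat n F).toBlocks₁₁ := by
  obtain ⟨a, ha⟩ := even_eq hx
  ext1
  rw [evenElt_coe, ha, toBlocks_fromBlocks₁₁]

theorem cartanElt_eq (x : Fin n → F) : cartanElt x = evenElt (diagonal x) := rfl

theorem bracket_evenElt (a b : Matrix (Fin n) (Fin n) F) :
    bracket (evenElt a) (evenElt b) = evenElt (a * b - b * a) := by
  ext1
  rw [bracket_coe (evenElt_parity a) (evenElt_parity b)]
  simp only [koszul, evenElt_coe, fromBlocks_multiply, zero_ne_one, and_self, if_false, one_smul,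
    sub_eq_add_neg, fromBlocks_neg, fromBlocks_add]
  congr 1 <;> simp

theorem bracket_parity {i j : ZMod 2} {x y : pn n F} (hx : HasParity i x) (hy : HasParity j y) :
    HasParity (i + j) (bracket x y) := by
  have h2 : ∀ k : ZMod 2, k = 0 ∨ k = 1 := by decide
  unfold HasParity
  rw [bracket_coe hx hy]
  obtain ⟨x, a, b, c, hb, hc, rfl⟩ := x
  obtain ⟨y, a', b', c', hb', hc', rfl⟩ := y
  rcases h2 i with rfl | rfl <;> rcases h2 j with rfl | rfl <;>
    simp_all [HasParity, fromBlocks_multiply, sub_eq_add_neg, fromBlocks_neg, fromBlocks_add,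
      fromBlocks_smul, show (1 + 1 : ZMod 2) = 0 from rfl]

theorem IsDegOne.hasParity {x : pn n F} (hx : IsDegOne x) : HasParity 1 x := hx.1

end EvenElements

/-! ### Tensor product with the natural module -/

section NaturalTensor

variable {F : Type*} [Field F] {n : ℕ}

/-- The sign by which an element of parity i is moved past a basis vector of the natural module. -/
def basisSign (F : Type*) [Field F] (i : ZMod 2) : Fin n ⊕ Fin n → F
  | .inl _ => 1
  | .inr _ => if i = 1 then -1 else 1

/-- The automorphism of p(n) which is -1 on the odd part. -/
def parityAut : pn n F →ₗ[F] pn n F where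
  toFun x := ⟨fromBlocks (x : Mat n F).toBlocks₁₁ (-(x : Mat n F).toBlocks₁₂)
      (-(x : Mat n F).toBlocks₂₁) (x : Mat n F).toBlocks₂₂, by
    obtain ⟨x, a, b, c, hb, hc, rfl⟩ := x
    exact ⟨a, -b, -c, by simp [hb], by simp [hc], by simp⟩⟩
  map_add' x y := by
    ext1
    change fromBlocks (x.1.toBlocks₁₁ + y.1.toBlocks₁₁) (-(x.1.toBlocks₁₂ + y.1.toBlocks₁₂))
      (-(x.1.toBlocks₂₁ + y.1.toBlocks₂₁)) (x.1.toBlocks₂₂ + y.1.toBlocks₂₂) = _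
    rw [neg_add, neg_add, ← fromBlocks_add]
    rfl
  map_smul' r x := by
    ext1
    change fromBlocks (r • x.1.toBlocks₁₁) (-(r • x.1.toBlocks₁₂))
      (-(r • x.1.toBlocks₂₁)) (r • x.1.toBlocks₂₂) = _
    rw [← smul_neg, ← smul_neg, ← fromBlocks_smul]
    rfl

theorem parityAut_of_parity {i : ZMod 2} {x : pn n F} (hx : HasParity i x) :
    parityAut x = (if i = 1 then -1 else 1 : F) • x := by
  have h2 : ∀ k : ZMod 2, k = 0 ∨ k = 1 := by decide
  obtain ⟨x, a, b, c, hb, hc, rfl⟩ := x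
  ext1
  rcases h2 i with rfl | rfl <;>
    simp_all [HasParity, parityAut, fromBlocks_neg]

/-- The automorphism by which p(n) is moved past a basis vector of the natural module. -/
def basisTwist : Fin n ⊕ Fin n → pn n F →ₗ[F] pn n F
  | .inl _ => LinearMap.id
  | .inr _ => parityAut

theorem basisTwist_of_parity {i : ZMod 2} {x : pn n F} (hx : HasParity i x)
    (b : Fin n ⊕ Fin n) : basisTwist b x = basisSign F i b • x := by
  rcases b with b | b
  · simp [basisTwist, basisSign]
  · exact parityAut_of_parity hx

variable {R : Type*} [AddCommGroup R] [Module F R]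

/-- The action of matrices on the tensor product of the natural module with a space. -/
def matAct (R : Type*) [AddCommGroup R] [Module F R] :
    Mat n F →ₗ[F] Module.End F (Fin n ⊕ Fin n → R) where
  toFun X := LinearMap.pi fun b => ∑ c, X b c • LinearMap.proj c
  map_add' X Y := by
    refine LinearMap.ext fun G => funext fun b => ?_
    simp [add_smul, Finset.sum_add_distrib]
  map_smul' r X := by
    refine LinearMap.ext fun G => funext fun b => ?_
    simp [mul_smul, Finset.smul_sum]

theorem matAct_apply (X : Mat n F) (G : Fin n ⊕ Fin n → R) (b : Fin n ⊕ Fin n) :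
    matAct R X G b = ∑ c, X b c • G c := by
  simp [matAct]

theorem matAct_mul (X Y : Mat n F) : matAct R (X * Y) = matAct R X * matAct R Y := by
  refine LinearMap.ext fun G => funext fun b => ?_
  simp only [Module.End.mul_apply, matAct_apply, Matrix.mul_apply, Finset.sum_smul,
    Finset.smul_sum, smul_smul]
  exact Finset.sum_comm

theorem matAct_one : matAct R (1 : Mat n F) = 1 := by
  refine LinearMap.ext fun G => funext fun b => ?_
  simp [matAct_apply, Matrix.one_apply, ite_smul]

theorem matAct_pow (X : Mat n F) (k : ℕ) : matAct R (X ^ k) = matAct R X ^ k := by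
  induction k with
  | zero => simp [matAct_one]
  | succ k ih => rw [pow_succ, matAct_mul, ih, pow_succ]

/-- The action of an endomorphism of parity i on the second factor of the tensor product with
the natural module. -/
def signedAct (n : ℕ) (i : ZMod 2) (T : Module.End F R) : Module.End F (Fin n ⊕ Fin n → R) :=
  LinearMap.pi fun b => basisSign F i b • T ∘ₗ LinearMap.proj b

theorem signedAct_apply (i : ZMod 2) (T : Module.End F R) (G : Fin n ⊕ Fin n → R)
    (b : Fin n ⊕ Fin n) : signedAct n i T G b = basisSign F i b • T (G b) := rfl

theorem signedAct_mul (i j : ZMod 2) (S T : Module.End F R) :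
    signedAct n i S * signedAct n j T = signedAct n (i + j) (S * T) := by
  have h2 : ∀ k : ZMod 2, k = 0 ∨ k = 1 := by decide
  refine LinearMap.ext fun G => funext fun b => ?_
  rcases h2 i with rfl | rfl <;> rcases h2 j with rfl | rfl <;> rcases b with b | b <;>
    simp [signedAct_apply, basisSign, show (1 + 1 : ZMod 2) = 0 from rfl]

theorem signedAct_sub_smul (i : ZMod 2) (S T : Module.End F R) (r : F) :
    signedAct n i (S - r • T) = signedAct n i S - r • signedAct n i T := by
  refine LinearMap.ext fun G => funext fun b => ?_
  simp [signedAct_apply, smul_sub, smul_comm r]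

theorem signedAct_pow (T : Module.End F R) (k : ℕ) :
    signedAct n 0 T ^ k = signedAct n 0 (T ^ k) := by
  induction k with
  | zero => refine LinearMap.ext fun G => funext fun b => ?_; rcases b with b | b <;> simp [signedAct_apply, basisSign]
  | succ k ih => rw [pow_succ, ih, signedAct_mul, pow_succ, add_zero]

/-- The sign rule: operators on the two tensor factors supercommute. An odd matrix exchanges the
even and odd basis vectors, on which the signs of an odd `signedAct` are opposite. -/
theorem matAct_mul_signedAct {i : ZMod 2} (j : ZMod 2) {x : pn n F} (hx : HasParity i x)
    (T : Module.End F R) : matAct R (x : Mat n F) * signedAct n j T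
      = koszul F i j • (signedAct n j T * matAct R (x : Mat n F)) := by
  have h2 : ∀ k : ZMod 2, k = 0 ∨ k = 1 := by decide
  obtain ⟨x, a, b, c, hb, hc, rfl⟩ := x
  refine LinearMap.ext fun G => funext fun b => ?_
  rcases h2 i with rfl | rfl <;> rcases h2 j with rfl | rfl <;> rcases b with b | b <;>
    simp_all [HasParity, koszul, signedAct_apply, basisSign, matAct_apply]

/-- The representation on the tensor product of the natural module with a representation. -/
def natTensor (φ : pn n F →ₗ[F] Module.End F R) :
    pn n F →ₗ[F] Module.End F (Fin n ⊕ Fin n → R) where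
  toFun x := matAct R (x : Mat n F) + LinearMap.pi fun b => φ (basisTwist b x) ∘ₗ LinearMap.proj b
  map_add' x y := by
    refine LinearMap.ext fun G => funext fun b => ?_
    simp; abel
  map_smul' r x := by
    refine LinearMap.ext fun G => funext fun b => ?_
    simp

theorem natTensor_apply (φ : pn n F →ₗ[F] Module.End F R) (x : pn n F)
    (G : Fin n ⊕ Fin n → R) (b : Fin n ⊕ Fin n) :
    natTensor φ x G b = ∑ c, (x : Mat n F) b c • G c + φ (basisTwist b x) (G b) := by
  rw [← matAct_apply]; rfl

theorem natTensor_of_parity (φ : pn n F →ₗ[F] Module.End F R) {i : ZMod 2} {x : pn n F}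
    (hx : HasParity i x) :
    natTensor φ x = matAct R (x : Mat n F) + signedAct n i (φ x) := by
  refine LinearMap.ext fun G => funext fun b => ?_
  rw [natTensor_apply, basisTwist_of_parity hx]
  simp [matAct_apply, signedAct_apply]

theorem koszul_comm (i j : ZMod 2) : koszul F i j = koszul F j i := by
  simp [koszul, and_comm]

theorem koszul_mul_self (i j : ZMod 2) : koszul F i j * koszul F i j = 1 := by
  unfold koszul; split_ifs <;> simp

theorem add_pow_char_of_commute' {A : Type*} [Ring A] [Algebra F A] (p : ℕ) [Fact p.Prime]
    [CharP F p] {a b : A} (h : Commute a b) : (a + b) ^ p = a ^ p + b ^ p := by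
  obtain ⟨r, hr⟩ := h.exists_add_pow_prime_eq (Fact.out : p.Prime)
  have h0 : ((p : ℕ) : A) = 0 := by
    rw [← map_natCast (algebraMap F A), CharP.cast_eq_zero, map_zero]
  rw [hr, h0, zero_mul, zero_mul, zero_mul, add_zero]

/-- The mixed terms of a superbracket cancel because the two actions supercommute. For even x they
commute, so the p-th power of their sum is the sum of the p-th powers. -/
theorem isRep_natTensor {p : ℕ} [Fact p.Prime] [CharP F p] {φ : pn n F →ₗ[F] Module.End F R}
    (h : IsRep p φ) : IsRep p (natTensor φ) where
  bracket i j x y hx hy := by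
    rw [natTensor_of_parity φ hx, natTensor_of_parity φ hy,
      natTensor_of_parity φ (bracket_parity hx hy), ← h.bracket i j x y hx hy,
      signedAct_sub_smul, bracket_coe hx hy, map_sub, map_smul, matAct_mul, matAct_mul,
      ← signedAct_mul, add_comm i j, ← signedAct_mul]
    simp only [mul_add, add_mul, matAct_mul_signedAct j hx, matAct_mul_signedAct i hy,
      koszul_comm j i, smul_add, smul_smul, koszul_mul_self, one_smul]
    abel
  pPower x hx := by
    have hp : HasParity 0 (pMap p x hx) := by
      obtain ⟨a, ha⟩ := even_eq hx
      have : (pMap p x hx : Mat n F) = (x : Mat n F) ^ p := rfl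
      simp [HasParity, this, ha, fromBlocks_diag_pow]
    have hc := matAct_mul_signedAct 0 hx (φ x)
    simp only [koszul, zero_ne_one, and_self, if_false, one_smul] at hc
    rw [natTensor_of_parity φ hx, natTensor_of_parity φ hp,
      add_pow_char_of_commute' (F := F) p hc, signedAct_pow, h.pPower x hx, ← matAct_pow]
    rfl

end NaturalTensor

/-! ### Divided powers of the natural module, built inside iterated tensor products -/

section DividedPowers

universe u

variable {F : Type u} [Field F] {p : ℕ} [Fact p.Prime] [CharP F p] {n : ℕ}

/-- The shift of exponents of divided power monomials by the root εᵢ - εⱼ. -/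
def shift (i j : Fin n) (μ : Fin n → ℤ) : Fin n → ℤ := μ + Pi.single i 1 - Pi.single j 1

variable (p) in
/-- A representation on R' with maps Ψ μ from R to R' that behave like the maps w ↦ x^(μ) ⊗ w to the
tensor product of the N-th divided power of the natural module with R, where x^(μ) is a divided
power monomial in the even basis vectors. -/
structure IsDividedPower {R R' : Type u} [AddCommGroup R] [Module F R] [AddCommGroup R']
    [Module F R'] (φ : pn n F →ₗ[F] Module.End F R) (φ' : pn n F →ₗ[F] Module.End F R') (N : ℕ)
    (Ψ : (Fin n → ℤ) → R →ₗ[F] R') : Prop where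
  isRep : IsRep p φ'
  degOne : ∀ b, IsDegOne b → ∀ μ w, φ' b (Ψ μ w) = Ψ μ (φ b w)
  even : ∀ (a : Matrix (Fin n) (Fin n) F) μ w, φ' (evenElt a) (Ψ μ w) =
    ∑ i, ∑ j, (a i j * (shift i j μ i : F)) • Ψ (shift i j μ) w + Ψ μ (φ (evenElt a) w)
  neg : ∀ μ i, μ i < 0 → Ψ μ = 0
  coord : ∀ ν : Fin n → ℤ, (∀ i, 0 ≤ ν i) → ∑ i, ν i = N →
    ∃ l : R' →ₗ[F] R, ∀ μ, l ∘ₗ Ψ μ = if μ = ν then LinearMap.id else 0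

/-- Only the monomial 1 is present. In the formula for even elements a term survives only if its
shifted exponent is 0, and then its coefficient, an entry of that exponent, is 0 as well. -/
theorem isDividedPower_zero {R : Type u} [AddCommGroup R] [Module F R]
    {φ : pn n F →ₗ[F] Module.End F R} (h : IsRep p φ) :
    IsDividedPower p φ φ 0 (fun μ => if μ = 0 then LinearMap.id else 0) where
  isRep := h
  degOne b _ μ w := by split_ifs <;> simp
  even a μ w := by
    have : ∀ i j, (a i j * (shift i j μ i : F)) •
        (if shift i j μ = 0 then (LinearMap.id : R →ₗ[F] R) else 0) w = 0 := by
      intro i j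
      by_cases h0 : shift i j μ = 0
      · simp [h0]
      · simp [h0]
    simp only [this, Finset.sum_const_zero, zero_add]
    split_ifs <;> simp
  neg μ i hi := by
    rw [if_neg]
    rintro rfl
    simp at hi
  coord ν h0 hν := by
    have : ν = 0 := by
      ext i
      simpa using (Finset.sum_eq_zero_iff_of_nonneg fun i _ => h0 i).1 hν i (Finset.mem_univ i)
    exact ⟨LinearMap.id, fun μ => by rw [this]; split_ifs <;> simp⟩

/-- The maps Ψ for the next divided power. -/
def nextDividedPower {R R' : Type u} [AddCommGroup R] [Module F R] [AddCommGroup R']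
    [Module F R'] (Ψ : (Fin n → ℤ) → R →ₗ[F] R') (μ : Fin n → ℤ) :
    R →ₗ[F] (Fin n ⊕ Fin n → R') :=
  LinearMap.pi (Sum.elim (fun l => Ψ (μ - Pi.single l 1)) 0)

theorem nextDividedPower_inl {R R' : Type u} [AddCommGroup R] [Module F R] [AddCommGroup R']
    [Module F R'] (Ψ : (Fin n → ℤ) → R →ₗ[F] R') (μ : Fin n → ℤ) (w : R) (l : Fin n) :
    nextDividedPower Ψ μ w (.inl l) = Ψ (μ - Pi.single l 1) w := rfl

theorem nextDividedPower_inr {R R' : Type u} [AddCommGroup R] [Module F R] [AddCommGroup R']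
    [Module F R'] (Ψ : (Fin n → ℤ) → R →ₗ[F] R') (μ : Fin n → ℤ) (w : R) (l : Fin n) :
    nextDividedPower Ψ μ w (.inr l) = 0 := rfl

/-- `nextDividedPower` encodes the comultiplication x^(μ) ↦ ∑ xₗ ⊗ x^(μ - εₗ). Elements of degree 1
annihilate every xₗ, so they act on the last factor only. -/
theorem isDividedPower_succ {R R' : Type u} [AddCommGroup R] [Module F R] [AddCommGroup R']
    [Module F R'] {φ : pn n F →ₗ[F] Module.End F R} {φ' : pn n F →ₗ[F] Module.End F R'} {N : ℕ}
    {Ψ : (Fin n → ℤ) → R →ₗ[F] R'} (h : IsDividedPower p φ φ' N Ψ) :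
    IsDividedPower p φ (natTensor φ') (N + 1) (nextDividedPower Ψ) where
  isRep := isRep_natTensor h.isRep
  degOne b hb μ w := by
    have h11 : ∀ i j, (b : Mat n F) (.inl i) (.inl j) = 0 := fun i j => congrFun₂ hb.1 i j
    have h21 : ∀ i j, (b : Mat n F) (.inr i) (.inl j) = 0 := fun i j => congrFun₂ hb.2 i j
    funext c
    rcases c with c | c
    · simp [natTensor_apply, nextDividedPower_inl, nextDividedPower_inr, h11, basisTwist,
        h.degOne b hb]
    · simp [natTensor_apply, nextDividedPower_inl, nextDividedPower_inr, h21]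
  even a μ w := by
    funext c
    simp only [natTensor_apply, Pi.add_apply, Finset.sum_apply, Pi.smul_apply]
    rcases c with c | c
    · have hs : ∀ i j, shift i j (μ - Pi.single c 1) = shift i j μ - Pi.single c 1 := fun i j => by
        unfold shift; abel
      simp only [Fintype.sum_sum_type, nextDividedPower_inl, nextDividedPower_inr, basisTwist,
        LinearMap.id_apply, h.even, evenElt_coe, fromBlocks_apply₁₁, smul_zero, hs,
        Finset.sum_const_zero, add_zero]
      rw [← add_assoc]
      congr 1
      -- In the component of x_c the exponent is lowered by ε_c, so the coefficients with i = c are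
      -- too small by one. The missing terms are exactly those that come from the action of a on the
      -- first tensor factor.
      have h1 : ∀ i j, (a i j * ((((shift i j μ - Pi.single c 1 : Fin n → ℤ)) i : ℤ) : F)) •
          Ψ (shift i j μ - Pi.single c 1) w = (a i j * ((shift i j μ i : ℤ) : F)) •
          Ψ (shift i j μ - Pi.single c 1) w
          - (if i = c then a i j • Ψ (shift i j μ - Pi.single c 1) w else 0) := by
        intro i j
        rcases eq_or_ne i c with rfl | hic
        · simp [mul_sub, sub_smul]
        · simp [hic]
      simp only [h1, Finset.sum_sub_distrib]
      rw [Finset.sum_comm (f := fun i j => if i = c then _ else _)]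
      simp only [Finset.sum_ite_eq', Finset.mem_univ, if_true]
      have h2 : ∀ j, shift c j μ - Pi.single c 1 = μ - Pi.single j 1 := fun j => by
        unfold shift; abel
      simp only [h2]
      abel
    · simp [Fintype.sum_sum_type, nextDividedPower_inl, nextDividedPower_inr, evenElt_coe]
  neg μ i hi := by
    have : ∀ l, Ψ (μ - Pi.single l 1) = 0 := fun l => by
      refine h.neg _ i ?_
      have : (0 : ℤ) ≤ Pi.single (M := fun _ => ℤ) l 1 i := by
        rw [Pi.single_apply]; split_ifs <;> simp
      simp only [Pi.sub_apply]
      omega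
    refine LinearMap.ext fun w => funext fun c => ?_
    rcases c with c | c
    · simp [nextDividedPower_inl, this]
    · simp [nextDividedPower_inr]
  coord ν h0 hν := by
    -- The coefficient of x^(ν) is read off in the component of any xₗ that occurs in the monomial;
    -- one exists because the degree is N + 1.
    obtain ⟨l, hl⟩ : ∃ l, 0 < ν l := by
      by_contra! hc
      have := Finset.sum_nonpos fun i (_ : i ∈ Finset.univ) => hc i
      omega
    obtain ⟨f, hf⟩ := h.coord (ν - Pi.single l 1) (fun i => by
      have := h0 i
      rcases eq_or_ne i l with rfl | hi
      · simp; omega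
      · simpa [hi] using this) (by simp [Finset.sum_sub_distrib, hν])
    refine ⟨f ∘ₗ LinearMap.proj (.inl l), fun μ => ?_⟩
    have e : (f ∘ₗ LinearMap.proj (.inl l)) ∘ₗ nextDividedPower Ψ μ
        = f ∘ₗ Ψ (μ - Pi.single l 1) := rfl
    rw [e, hf]
    simp

theorem exists_isDividedPower {R : Type u} [AddCommGroup R] [Module F R]
    {φ : pn n F →ₗ[F] Module.End F R} (h : IsRep p φ) (N : ℕ) :
    ∃ (R' : Type u) (_ : AddCommGroup R') (_ : Module F R') (φ' : pn n F →ₗ[F] Module.End F R')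
      (Ψ : (Fin n → ℤ) → R →ₗ[F] R'), IsDividedPower p φ φ' N Ψ := by
  induction N with
  | zero => exact ⟨R, _, _, φ, _, isDividedPower_zero h⟩
  | succ N ih =>
    obtain ⟨R', _, _, φ', Ψ, hΨ⟩ := ih
    exact ⟨_, _, _, _, _, isDividedPower_succ hΨ⟩

end DividedPowers

/-! ### Singular vectors of all restricted weights -/

section Singular

universe u

variable {F : Type u} [Field F] {p : ℕ} [Fact p.Prime] [CharP F p] {n : ℕ}

/-- Nonzero vectors of weight lam killed by the positive root vectors. -/
structure IsSingular {R : Type*} [AddCommGroup R] [Module F R] (φ : pn n F → Module.End F R)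
    (lam : Fin n → F) (v : R) : Prop where
  ne_zero : v ≠ 0
  pos : ∀ x, IsEvenPos x ∨ IsDegOne x → φ x v = 0
  weight : ∀ x, φ (cartanElt x) v = (∑ i, x i * lam i) • v

/-- The root vector of the negative of the i-th simple root. -/
def simpleNeg (F : Type*) [Field F] (i : ℕ) (hi : i + 1 < n) : pn n F :=
  evenElt (Matrix.single ⟨i + 1, hi⟩ ⟨i, by omega⟩ 1)

variable (p) in
/-- The exponents p - 1 before position i, r at position i and 0 after it. -/
def stepWeight (i : Fin n) (r : ℕ) (l : Fin n) : ℤ :=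
  if l < i then p - 1 else if l = i then r else 0

/-- Let a < b. If a < i, the root vector of εₐ - ε_b raises the exponent p - 1 at a to p, which is
also the coefficient and so vanishes. If a ≥ i, then b > i has exponent 0, which would become
negative. -/
theorem IsDividedPower.isSingular {R R' : Type u} [AddCommGroup R] [Module F R] [AddCommGroup R']
    [Module F R'] {φ : pn n F →ₗ[F] Module.End F R} {φ' : pn n F →ₗ[F] Module.End F R'} {N : ℕ}
    {Ψ : (Fin n → ℤ) → R →ₗ[F] R'} (h : IsDividedPower p φ φ' N Ψ) {lam : Fin n → F} {v : R}
    (hv : IsSingular φ lam v) {i : Fin n} {r : ℕ} (hN : ∑ l, stepWeight p i r l = N) :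
    IsSingular φ' (fun l => lam l + (stepWeight p i r l : F)) (Ψ (stepWeight p i r) v) where
  ne_zero h0 := by
    obtain ⟨l, hl⟩ := h.coord (stepWeight p i r) (fun l => by
      have := (Fact.out : p.Prime).one_lt
      unfold stepWeight; split_ifs <;> omega) hN
    have := LinearMap.congr_fun (hl (stepWeight p i r)) v
    rw [if_pos rfl, LinearMap.comp_apply, h0, map_zero] at this
    exact hv.ne_zero this.symm
  pos x hx := by
    rcases hx with hx | hx
    · rw [eq_evenElt hx.1, h.even, ← eq_evenElt hx.1, hv.pos x (.inl hx), map_zero, add_zero]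
      refine Finset.sum_eq_zero fun a _ => Finset.sum_eq_zero fun b _ => ?_
      rcases le_or_gt b a with hab | hab
      · rw [hx.2 a b hab, zero_mul, zero_smul]
      · rcases lt_or_ge a i with hai | hai
        · have : shift a b (stepWeight p i r) a = p := by
            simp [shift, stepWeight, hai, hab.ne]
          rw [this]
          simp
        · rw [h.neg _ b, LinearMap.zero_apply, smul_zero]
          have : ¬ b < i := not_lt.2 (hai.trans hab.le)
          have h' : b ≠ i := (hai.trans_lt hab).ne'
          simp [shift, stepWeight, this, h', hab.ne']
    · rw [h.degOne x hx, hv.pos x (.inr hx), map_zero]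
  weight x := by
    have h1 : ∀ a b, ((diagonal x) a b * ((shift a b (stepWeight p i r) a : ℤ) : F)) •
        Ψ (shift a b (stepWeight p i r)) v =
        if a = b then (x a * (stepWeight p i r a : F)) • Ψ (stepWeight p i r) v else 0 := by
      intro a b
      rcases eq_or_ne a b with rfl | hab
      · simp [shift]
      · simp [hab]
    rw [cartanElt_eq, h.even, ← cartanElt_eq, hv.weight, map_smul]
    simp only [h1, Finset.sum_ite_eq, Finset.mem_univ, if_true, mul_add,
      Finset.sum_add_distrib, add_smul, Finset.sum_smul]
    exact add_comm _ _

theorem IsDividedPower.simpleNeg_apply {R R' : Type u} [AddCommGroup R] [Module F R]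
    [AddCommGroup R'] [Module F R'] {φ : pn n F →ₗ[F] Module.End F R}
    {φ' : pn n F →ₗ[F] Module.End F R'} {N : ℕ} {Ψ : (Fin n → ℤ) → R →ₗ[F] R'}
    (h : IsDividedPower p φ φ' N Ψ) (i : ℕ) (hi : i + 1 < n) (μ : Fin n → ℤ) (w : R) :
    φ' (simpleNeg F i hi) (Ψ μ w) = ((μ ⟨i + 1, hi⟩ + 1 : ℤ) : F) •
      Ψ (shift ⟨i + 1, hi⟩ ⟨i, by omega⟩ μ) w + Ψ μ (φ (simpleNeg F i hi) w) := by
  rw [simpleNeg, h.even]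
  congr 1
  rw [Finset.sum_eq_single (⟨i + 1, hi⟩ : Fin n),
    Finset.sum_eq_single (⟨i, by omega⟩ : Fin n)]
  · simp [shift]
  · intro b _ (hb : b ≠ ⟨i, Nat.lt_of_succ_lt hi⟩)
    rw [Matrix.single_apply, if_neg (fun hc => hb hc.2.symm), zero_mul, zero_smul]
  · simp
  · intro b _ hb
    refine Finset.sum_eq_zero fun c _ => ?_
    rw [Matrix.single_apply, if_neg (fun hc => hb hc.1.symm), zero_mul, zero_smul]
  · simp

/-- Each application of f may move one unit of the exponent from position i to i + 1. Moving all j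
units gives the term j! x^(ν j) ⊗ v; all other terms have a smaller exponent at i + 1. The
functional for ν j isolates this term, and p does not divide j!. -/
theorem IsDividedPower.simpleNeg_pow_ne_zero {R R' : Type u} [AddCommGroup R] [Module F R]
    [AddCommGroup R'] [Module F R'] {φ : pn n F →ₗ[F] Module.End F R}
    {φ' : pn n F →ₗ[F] Module.End F R'} {N : ℕ} {Ψ : (Fin n → ℤ) → R →ₗ[F] R'}
    (h : IsDividedPower p φ φ' N Ψ) {v : R} (hv : v ≠ 0) {i : ℕ} (hi : i + 1 < n)
    (hN : ∑ l, stepWeight p (⟨i, by omega⟩ : Fin n) (p - 1) l = N) {j : ℕ} (hj : j < p) :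
    (φ' (simpleNeg F i hi) ^ j) (Ψ (stepWeight p (⟨i, by omega⟩ : Fin n) (p - 1)) v) ≠ 0 := by
  set i₀ : Fin n := ⟨i, by omega⟩ with hi₀
  set i₁ : Fin n := ⟨i + 1, hi⟩ with hi₁
  have hne : i₁ ≠ i₀ := by simp [hi₀, hi₁]
  set μ := stepWeight p i₀ (p - 1)
  let ν : ℕ → Fin n → ℤ := fun a => μ + Pi.single i₁ (a : ℤ) - Pi.single i₀ (a : ℤ)
  have hν1 : ∀ a, ν a i₁ = a := fun a => by
    have h1 : ¬ i₁ < i₀ := by simp [hi₀, hi₁, Fin.lt_def]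
    simp [ν, μ, stepWeight, hne, h1]
  have hνs : ∀ a, shift i₁ i₀ (ν a) = ν (a + 1) := fun a => by
    simp only [ν, shift, Nat.cast_add, Nat.cast_one, Pi.single_add]
    abel
  have hf : ∀ a w, φ' (simpleNeg F i hi) (Ψ (ν a) w) = ((a + 1 : ℕ) : F) • Ψ (ν (a + 1)) w
      + Ψ (ν a) (φ (simpleNeg F i hi) w) := fun a w => by
    rw [h.simpleNeg_apply, hν1, hνs]
    push_cast; rfl
  -- The terms in which fewer than j units have been moved, with arbitrary vectors of R as second
  -- factor.
  let S : ℕ → Submodule F R' := fun j => ⨆ a : {a : ℕ // a < j}, LinearMap.range (Ψ (ν a))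
  have hS : ∀ {a j} (_ : a < j) w, Ψ (ν a) w ∈ S j := fun {a j} ha w =>
    Submodule.mem_iSup_of_mem (⟨a, ha⟩ : {a : ℕ // a < j}) ⟨w, rfl⟩
  have hfS : ∀ j, ∀ x ∈ S j, φ' (simpleNeg F i hi) x ∈ S (j + 1) := by
    intro j
    change S j ≤ (S (j + 1)).comap _
    refine iSup_le ?_
    rintro ⟨a, ha⟩ _ ⟨w, rfl⟩
    rw [Submodule.mem_comap, hf]
    exact add_mem (Submodule.smul_mem _ _ (hS (Nat.succ_lt_succ ha) _))
      (hS (Nat.lt_succ_of_lt ha) _)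
  have key : ∀ j, (φ' (simpleNeg F i hi) ^ j) (Ψ μ v) - (j.factorial : F) • Ψ (ν j) v ∈ S j := by
    intro j
    induction j with
    | zero => simp [ν]
    | succ j ih =>
      have h1 := hfS j _ ih
      rw [map_sub, ← Module.End.mul_apply, ← pow_succ', map_smul, hf, smul_add, smul_smul] at h1
      have h2 : (j.factorial : F) • Ψ (ν j) (φ (simpleNeg F i hi) v) ∈ S (j + 1) :=
        Submodule.smul_mem _ _ (hS (by omega) _)
      have h3 := add_mem h1 h2
      have e : ((j + 1).factorial : F) = j.factorial * ((j + 1 : ℕ) : F) := by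
        rw [Nat.factorial_succ]; push_cast; ring
      rw [e]
      convert h3 using 1
      abel
  intro h0
  have h1 := key j
  rw [h0, zero_sub, neg_mem_iff] at h1
  have hp1 := (Fact.out : p.Prime).one_lt
  have h01 : ∀ l, 0 ≤ ν j l := fun l => by
    rcases eq_or_ne l i₁ with rfl | hl1
    · rw [hν1]; omega
    rcases eq_or_ne l i₀ with rfl | hl0
    · simp [ν, μ, stepWeight, hne.symm]; omega
    · simp only [ν, μ, stepWeight, Pi.sub_apply, Pi.add_apply, Pi.single_eq_of_ne hl1,
        Pi.single_eq_of_ne hl0]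
      split_ifs <;> omega
  obtain ⟨l, hl⟩ := h.coord (ν j) h01 (by simp [ν, Finset.sum_sub_distrib, Finset.sum_add_distrib]; exact hN)
  have hlS : S j ≤ LinearMap.ker l := by
    refine iSup_le ?_
    rintro ⟨a, ha⟩ _ ⟨w, rfl⟩
    have hne' : ν a ≠ ν j := fun hc => by
      have := congrFun hc i₁
      rw [hν1, hν1] at this
      omega
    have := LinearMap.congr_fun (hl (ν a)) w
    rwa [if_neg hne'] at this
  have h2 := hlS h1
  have h3 := LinearMap.congr_fun (hl (ν j)) v
  rw [if_pos rfl, LinearMap.comp_apply, LinearMap.id_apply] at h3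
  rw [LinearMap.mem_ker, map_smul, h3, smul_eq_zero, or_iff_left hv] at h2
  rw [CharP.cast_eq_zero_iff F p, (Fact.out : p.Prime).dvd_factorial] at h2
  omega

variable (p) in
/-- Some representation has a singular vector of weight lam. -/
def HasSingular (lam : Fin n → F) : Prop :=
  ∃ (R : Type u) (_ : AddCommGroup R) (_ : Module F R) (φ : pn n F →ₗ[F] Module.End F R) (v : R),
    IsRep p φ ∧ IsSingular φ lam v

theorem sum_stepWeight_nonneg (i : Fin n) (r : ℕ) : 0 ≤ ∑ l, stepWeight p i r l := by
  have := (Fact.out : p.Prime).one_lt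
  exact Finset.sum_nonneg fun l _ => by unfold stepWeight; split_ifs <;> omega

theorem HasSingular.add_stepWeight {lam : Fin n → F} (h : HasSingular p lam) (i : Fin n) (r : ℕ) :
    HasSingular p fun l => lam l + (stepWeight p i r l : F) := by
  obtain ⟨R, _, _, φ, v, hφ, hv⟩ := h
  obtain ⟨N, hN⟩ := Int.eq_ofNat_of_zero_le (sum_stepWeight_nonneg (p := p) i r)
  obtain ⟨R', _, _, φ', Ψ, hΨ⟩ := exists_isDividedPower hφ N
  exact ⟨R', _, _, φ', _, hΨ.isRep, hΨ.isSingular hv hN⟩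

theorem hasSingular_zero : HasSingular (F := F) p (0 : Fin n → F) := by
  refine ⟨F, _, _, 0, 1, ⟨?_, ?_⟩, one_ne_zero, ?_, ?_⟩
  · intros; simp
  · intros; simp [(Fact.out : p.Prime).ne_zero]
  · intros; simp
  · intros; simp

/-- The p elements of the prime field are all the roots of X^p - X. -/
theorem exists_natCast_eq {c : F} (hc : c ^ p = c) : ∃ r : ℕ, r < p ∧ (r : F) = c := by
  have h := prod_X_sub_C_castHom (F := F) (p := p)
  have h' := congrArg (Polynomial.eval c) h
  rw [Polynomial.eval_prod] at h'
  simp only [Polynomial.eval_sub, Polynomial.eval_X, Polynomial.eval_C, Polynomial.eval_pow, hc,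
    sub_self, Finset.prod_eq_zero_iff, Finset.mem_univ, true_and, sub_eq_zero] at h'
  obtain ⟨a, ha⟩ := h'
  refine ⟨a.val, ZMod.val_lt a, ?_⟩
  rw [ha, ← map_natCast (ZMod.castHom (dvd_refl p) F), ZMod.natCast_zmod_val]

theorem stepWeight_isRestricted (i : Fin n) (r : ℕ) :
    IsRestricted p fun l => (stepWeight p i r l : F) := fun l => by
  rw [← frobenius_def, map_intCast]

/-- Every restricted weight is the weight of a singular vector. -/
theorem hasSingular {lam : Fin n → F} (hl : IsRestricted p lam) : HasSingular p lam := by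
  suffices h : ∀ k ≤ n, ∀ lam : Fin n → F, IsRestricted p lam → (∀ l : Fin n, k ≤ l → lam l = 0) →
      HasSingular p lam from h n le_rfl lam hl fun l hl => absurd l.2 (by omega)
  intro k
  induction k with
  | zero =>
    intro _ lam _ h0
    rw [show lam = 0 from funext fun l => h0 l (Nat.zero_le _)]
    exact hasSingular_zero
  | succ k ih =>
    intro hk lam hlam h0
    let i : Fin n := ⟨k, hk⟩
    obtain ⟨r, -, hr⟩ := exists_natCast_eq (hlam i)
    -- Subtracting the step with r = λ_k at position k makes the weight vanish from position k on.
    -- It also changes the earlier entries, about which the induction hypothesis assumes nothing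
    -- beyond being restricted.
    have := (ih (by omega) (fun l => lam l - (stepWeight p i r l : F)) (fun l => by
      rw [sub_pow_char, hlam, stepWeight_isRestricted]) (fun l hl => by
      rcases eq_or_ne l i with rfl | hli
      · simp [stepWeight, hr]
      · have h1 : ¬ l < i := by simp [i, Fin.lt_def]; omega
        have h2 : (l : ℕ) ≠ k := fun hc => hli (Fin.ext hc)
        simp [stepWeight, hli, h1, h0 l (by omega)])).add_stepWeight i r
    simpa using this

/-- For a simple root and a restricted weight, there is a representation with a singular vector
of that weight on which the first p - 1 powers of the negative root vector do not vanish. -/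
theorem exists_isSingular {lam : Fin n → F} (hl : IsRestricted p lam) (i : ℕ) (hi : i + 1 < n) :
    ∃ (R : Type u) (_ : AddCommGroup R) (_ : Module F R) (φ : pn n F →ₗ[F] Module.End F R) (v : R),
      IsRep p φ ∧ IsSingular φ lam v ∧ ∀ j < p, (φ (simpleNeg F i hi) ^ j) v ≠ 0 := by
  let i₀ : Fin n := ⟨i, by omega⟩
  -- The starting weight is chosen so that one last step, with exponent p - 1 at i and 0 at i + 1,
  -- ends at λ; that step makes the powers of f nonzero.
  obtain ⟨R, _, _, φ, v, hφ, hv⟩ :=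
    hasSingular (lam := fun l => lam l - (stepWeight p i₀ (p - 1) l : F)) (fun l => by
      rw [sub_pow_char, hl, stepWeight_isRestricted])
  obtain ⟨N, hN⟩ := Int.eq_ofNat_of_zero_le (sum_stepWeight_nonneg (p := p) i₀ (p - 1))
  obtain ⟨R', _, _, φ', Ψ, hΨ⟩ := exists_isDividedPower hφ N
  have := hΨ.isSingular hv hN
  simp only [sub_add_cancel] at this
  exact ⟨R', _, _, φ', _, hΨ.isRep, this, fun j hj => hΨ.simpleNeg_pow_ne_zero hv.ne_zero hi hN hj⟩

end Singular

/-! ### The component of degree -1 -/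

section DegNeg

variable {F : Type*} [Field F] {n : ℕ}

variable (n F) in
/-- The component of p(n) of ℤ-degree -1, where a = b = 0. -/
def degNeg : Submodule F (pn n F) where
  carrier := {x | (x : Mat n F).toBlocks₁₁ = 0 ∧ (x : Mat n F).toBlocks₁₂ = 0}
  zero_mem' := ⟨rfl, rfl⟩
  add_mem' {x y} hx hy := by
    constructor
    · change (x : Mat n F).toBlocks₁₁ + (y : Mat n F).toBlocks₁₁ = 0
      rw [hx.1, hy.1, add_zero]
    · change (x : Mat n F).toBlocks₁₂ + (y : Mat n F).toBlocks₁₂ = 0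
      rw [hx.2, hy.2, add_zero]
  smul_mem' r x hx := by
    constructor
    · change r • (x : Mat n F).toBlocks₁₁ = 0
      rw [hx.1, smul_zero]
    · change r • (x : Mat n F).toBlocks₁₂ = 0
      rw [hx.2, smul_zero]

theorem degNeg_parity {x : pn n F} (hx : x ∈ degNeg F n) : HasParity 1 x := hx.1

theorem bracket_degNeg_degNeg {x y : pn n F} (hx : x ∈ degNeg F n) (hy : y ∈ degNeg F n) :
    bracket x y = 0 := by
  ext1
  rw [bracket_coe (degNeg_parity hx) (degNeg_parity hy)]
  obtain ⟨x, a, b, c, hb, hc, rfl⟩ := x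
  obtain ⟨y, a', b', c', hb', hc', rfl⟩ := y
  obtain ⟨h1, h2⟩ := hx
  obtain ⟨h3, h4⟩ := hy
  simp_all [fromBlocks_multiply]

theorem bracket_even_degNeg {x y : pn n F} (hx : HasParity 0 x) (hy : y ∈ degNeg F n) :
    bracket x y ∈ degNeg F n := by
  refine ⟨?_, ?_⟩ <;> rw [bracket_coe hx (degNeg_parity hy)] <;>
  · obtain ⟨x, a, b, c, hb, hc, rfl⟩ := x
    obtain ⟨y, a', b', c', hb', hc', rfl⟩ := y
    obtain ⟨h3, h4⟩ := hy
    simp_all [HasParity, koszul, fromBlocks_multiply, sub_eq_add_neg, fromBlocks_neg,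
      fromBlocks_add]

theorem bracket_degOne_even {x y : pn n F} (hx : IsDegOne x) (hy : HasParity 0 y) :
    IsDegOne (bracket x y) := by
  refine ⟨?_, ?_⟩ <;> rw [bracket_coe hx.hasParity hy] <;>
  · obtain ⟨x, a, b, c, hb, hc, rfl⟩ := x
    obtain ⟨y, a', b', c', hb', hc', rfl⟩ := y
    obtain ⟨h3, h4⟩ := hx
    simp_all [HasParity, koszul, fromBlocks_multiply, sub_eq_add_neg, fromBlocks_neg,
      fromBlocks_add]

theorem exists_degree_decomposition (x : pn n F) :
    ∃ y z w : pn n F, HasParity 0 y ∧ IsDegOne z ∧ w ∈ degNeg F n ∧ x = y + z + w := by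
  obtain ⟨x, a, b, c, hb, hc, rfl⟩ := x
  refine ⟨evenElt a, ⟨fromBlocks 0 b 0 0, 0, b, 0, hb, by simp, by simp⟩,
    ⟨fromBlocks 0 0 c 0, 0, 0, c, by simp, hc, by simp⟩, evenElt_parity a,
    ⟨by simp, by simp⟩, ⟨by simp, by simp⟩, ?_⟩
  ext1
  change _ = fromBlocks a 0 0 (-aᵀ) + fromBlocks 0 b 0 0 + fromBlocks 0 0 c 0
  simp [fromBlocks_add]

/-- A skew-symmetric block is determined by its entries below the diagonal; its diagonal vanishes
because 2 is invertible. -/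
theorem finrank_degNeg_le (h2 : (2 : F) ≠ 0) :
    Module.finrank F (degNeg F n) ≤ n * (n - 1) / 2 := by
  let f : degNeg F n →ₗ[F] ((Σ i : Fin n, Fin i) → F) :=
    { toFun := fun x q => (x : Mat n F) (.inr q.1) (.inl ⟨q.2, q.2.2.trans q.1.2⟩)
      map_add' := fun _ _ => rfl
      map_smul' := fun _ _ => rfl }
  have hf : Function.Injective f := by
    rw [injective_iff_map_eq_zero]
    rintro ⟨⟨x, a, b, c, hb, hc, rfl⟩, h11, h12⟩ h0
    simp only [toBlocks_fromBlocks₁₁, toBlocks_fromBlocks₁₂] at h11 h12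
    have hlt : ∀ i j : Fin n, j < i → c i j = 0 := fun i j hij => congrFun h0 ⟨i, ⟨j, hij⟩⟩
    have hcs : ∀ i j, c i j = - c j i := fun i j => by
      have := congrFun₂ hc j i
      simpa using this
    have : c = 0 := by
      ext i j
      rcases lt_trichotomy i j with h | rfl | h
      · rw [hcs, hlt _ _ h]; simp
      · have := hcs i i
        rw [eq_neg_iff_add_eq_zero, ← two_mul] at this
        exact (mul_eq_zero.1 this).resolve_left h2
      · exact hlt _ _ h
    ext1; ext1
    simp [h11, h12, this]
  refine (LinearMap.finrank_le_finrank_of_injective hf).trans (le_of_eq ?_)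
  rw [Module.finrank_fintype_fun_eq_card, Fintype.card_sigma]
  simp only [Fintype.card_fin]
  rw [Fin.sum_univ_eq_sum_range (fun i => i) n, Finset.sum_range_id]

end DegNeg

/-! ### The submodule on which long products of degree-1 elements vanish -/

section Truncation

variable {F : Type*} [Field F] {p : ℕ} [Fact p.Prime] [CharP F p] {n : ℕ}
  {R : Type*} [AddCommGroup R] [Module F R] {φ : pn n F →ₗ[F] Module.End F R}

theorem IsRep.swap (h : IsRep p φ) {i j : ZMod 2} {x y : pn n F} (hx : HasParity i x)
    (hy : HasParity j y) (v : R) :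
    φ x (φ y v) = koszul F i j • φ y (φ x v) + φ (Periplectic.bracket x y) v := by
  have := LinearMap.congr_fun (h.bracket i j x y hx hy) v
  rw [← this]
  simp

/-- Elements of degree -1 have bracket zero, so their images have square zero (2 being invertible)
and the action factors through the exterior algebra. A product with more factors than the dimension
is alternating in linearly dependent vectors. -/
theorem IsRep.degNeg_prod_eq_zero (h : IsRep p φ) (h2 : (2 : F) ≠ 0) {l : List (pn n F)}
    (hl : ∀ x ∈ l, x ∈ degNeg F n) (hlen : n * (n - 1) / 2 < l.length) : (l.map φ).prod = 0 := by
  let f : degNeg F n →ₗ[F] Module.End F R := φ ∘ₗ (degNeg F n).subtype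
  have hsq : ∀ c : degNeg F n, f c * f c = 0 := by
    intro c
    have := h.bracket 1 1 c c (degNeg_parity c.2) (degNeg_parity c.2)
    rw [bracket_degNeg_degNeg c.2 c.2, map_zero] at this
    simp only [koszul, and_self, if_true, neg_smul, one_smul, sub_neg_eq_add] at this
    rw [← two_smul F, smul_eq_zero] at this
    exact this.resolve_left h2
  let g : ExteriorAlgebra F (degNeg F n) →ₐ[F] Module.End F R := ExteriorAlgebra.lift F ⟨f, hsq⟩
  let v : Fin l.length → degNeg F n := fun i => ⟨l.get i, hl _ (List.get_mem l i)⟩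
  have hv : ¬ LinearIndependent F v := fun hli => by
    have := hli.fintype_card_le_finrank
    rw [Fintype.card_fin] at this
    exact absurd (this.trans (finrank_degNeg_le h2)) (by omega)
  have h0 := (ExteriorAlgebra.ιMulti F l.length).map_linearDependent v hv
  rw [ExteriorAlgebra.ιMulti_apply] at h0
  have h1 := congrArg g h0
  rw [map_zero, map_list_prod, List.map_ofFn] at h1
  rw [← h1]
  congr 1
  refine List.ext_get (by simp) fun i _ _ => ?_
  simp [g, v, f, ExteriorAlgebra.lift_ι_apply]

/-- The vectors killed by the elements of degree 1. -/
def topSpace (φ : pn n F →ₗ[F] Module.End F R) : Submodule F R where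
  carrier := {w | ∀ b, IsDegOne b → φ b w = 0}
  zero_mem' := fun b _ => map_zero _
  add_mem' := fun hx hy b hb => by rw [map_add, hx b hb, hy b hb, add_zero]
  smul_mem' := fun r x hx b hb => by rw [map_smul, hx b hb, smul_zero]

/-- The span of the products of fewer than k elements of degree -1, applied to `topSpace φ`. -/
def lowerSpace (φ : pn n F →ₗ[F] Module.End F R) (k : ℕ) : Submodule F R :=
  Submodule.span F {u | ∃ (l : List (pn n F)) (w : R), (∀ x ∈ l, x ∈ degNeg F n) ∧
    l.length < k ∧ w ∈ topSpace φ ∧ u = (l.map φ).prod w}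

theorem lowerSpace_zero : lowerSpace φ 0 = ⊥ := by
  rw [lowerSpace, Submodule.span_eq_bot]
  rintro _ ⟨l, w, -, hl, -⟩
  exact absurd hl (Nat.not_lt_zero _)

theorem topSpace_le {k : ℕ} (hk : 0 < k) : topSpace φ ≤ lowerSpace φ k := fun w hw =>
  Submodule.subset_span ⟨[], w, by simp, hk, hw, by simp⟩

theorem lowerSpace_mono {k k' : ℕ} (hk : k ≤ k') : lowerSpace φ k ≤ lowerSpace φ k' :=
  Submodule.span_mono fun _ ⟨l, w, h1, h2, h3⟩ => ⟨l, w, h1, h2.trans_le hk, h3⟩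

theorem degNeg_lowerSpace {k : ℕ} {c : pn n F} (hc : c ∈ degNeg F n) :
    ∀ u ∈ lowerSpace φ k, φ c u ∈ lowerSpace φ (k + 1) := by
  change lowerSpace φ k ≤ (lowerSpace φ (k + 1)).comap (φ c)
  refine Submodule.span_le.2 ?_
  rintro _ ⟨l, w, hl, hk, hw, rfl⟩
  exact Submodule.subset_span ⟨c :: l, w, List.forall_mem_cons.2 ⟨hc, hl⟩, by simpa using hk, hw, by simp⟩

theorem IsRep.even_topSpace (h : IsRep p φ) {a : pn n F} (ha : HasParity 0 a) {w : R}
    (hw : w ∈ topSpace φ) : φ a w ∈ topSpace φ := fun b hb => by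
  rw [h.swap hb.hasParity ha, hw b hb, hw _ (bracket_degOne_even hb ha), map_zero, smul_zero,
    add_zero]

/-- Moving a to the right past elements of degree -1 only replaces one of them by its bracket with
a, so the length does not grow; at the end a preserves the top space. -/
theorem IsRep.even_prod (h : IsRep p φ) {l : List (pn n F)} (hl : ∀ x ∈ l, x ∈ degNeg F n)
    {w : R} (hw : w ∈ topSpace φ) {a : pn n F} (ha : HasParity 0 a) :
    φ a ((l.map φ).prod w) ∈ lowerSpace φ (l.length + 1) := by
  induction l with
  | nil => exact topSpace_le (by simp) (h.even_topSpace ha hw)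
  | cons c l ih =>
    have hc : c ∈ degNeg F n := hl c (by simp)
    have hl' : ∀ x ∈ l, x ∈ degNeg F n := fun x hx => hl x (by simp [hx])
    rw [List.map_cons, List.prod_cons, Module.End.mul_apply, h.swap ha (degNeg_parity hc)]
    refine add_mem (Submodule.smul_mem _ _ (degNeg_lowerSpace hc _ (ih hl'))) ?_
    exact degNeg_lowerSpace (bracket_even_degNeg ha hc) _
      (Submodule.subset_span ⟨l, w, hl', by simp, hw, rfl⟩)

theorem IsRep.even_lowerSpace (h : IsRep p φ) {k : ℕ} {a : pn n F} (ha : HasParity 0 a) :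
    ∀ u ∈ lowerSpace φ k, φ a u ∈ lowerSpace φ k := by
  change lowerSpace φ k ≤ (lowerSpace φ k).comap (φ a)
  refine Submodule.span_le.2 ?_
  rintro _ ⟨l, w, hl, hk, hw, rfl⟩
  exact lowerSpace_mono hk (h.even_prod hl hw ha)

/-- Moving b to the right past c produces the even element [b, c] in place of c, which shortens the
product by one; what reaches the top space is killed there. -/
theorem IsRep.degOne_prod (h : IsRep p φ) {l : List (pn n F)} (hl : ∀ x ∈ l, x ∈ degNeg F n)
    {w : R} (hw : w ∈ topSpace φ) {b : pn n F} (hb : IsDegOne b) :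
    φ b ((l.map φ).prod w) ∈ lowerSpace φ l.length := by
  induction l with
  | nil => simp [hw b hb]
  | cons c l ih =>
    have hc : c ∈ degNeg F n := hl c (by simp)
    have hl' : ∀ x ∈ l, x ∈ degNeg F n := fun x hx => hl x (by simp [hx])
    rw [List.map_cons, List.prod_cons, Module.End.mul_apply, h.swap hb.hasParity (degNeg_parity hc)]
    refine add_mem (Submodule.smul_mem _ _ (degNeg_lowerSpace hc _ (ih hl'))) ?_
    exact h.even_prod hl' hw (bracket_parity hb.hasParity (degNeg_parity hc))

theorem IsRep.degOne_lowerSpace (h : IsRep p φ) {k : ℕ} {b : pn n F} (hb : IsDegOne b) :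
    ∀ u ∈ lowerSpace φ (k + 1), φ b u ∈ lowerSpace φ k := by
  change lowerSpace φ (k + 1) ≤ (lowerSpace φ k).comap (φ b)
  refine Submodule.span_le.2 ?_
  rintro _ ⟨l, w, hl, hk, hw, rfl⟩
  exact lowerSpace_mono (Nat.lt_succ_iff.1 hk) (h.degOne_prod hl hw hb)

theorem IsRep.degOne_list (h : IsRep p φ) {l : List (pn n F)} (hl : ∀ x ∈ l, IsDegOne x) {k : ℕ}
    {u : R} (hu : u ∈ lowerSpace φ k) : (l.map φ).prod u ∈ lowerSpace φ (k - l.length) := by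
  induction l with
  | nil => simpa using hu
  | cons b l ih =>
    have hb := hl b (by simp)
    have ih := ih fun x hx => hl x (by simp [hx])
    rw [List.map_cons, List.prod_cons, Module.End.mul_apply, List.length_cons]
    rcases Nat.eq_zero_or_pos (k - l.length) with h0 | h0
    · rw [h0, lowerSpace_zero, Submodule.mem_bot] at ih
      rw [ih, map_zero]
      exact zero_mem _
    · refine h.degOne_lowerSpace hb _ ?_
      convert ih using 2
      omega

/-- Even elements preserve the length filtration and elements of degree 1 lower it. Elements of
degree -1 raise it by one, but products longer than n(n-1)/2 are zero. -/
theorem IsRep.lowerSpace_stable (h : IsRep p φ) (h2 : (2 : F) ≠ 0) (x : pn n F) :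
    ∀ u ∈ lowerSpace φ (n * (n - 1) / 2 + 1), φ x u ∈ lowerSpace φ (n * (n - 1) / 2 + 1) := by
  intro u hu
  obtain ⟨y, z, w, hy, hz, hw, rfl⟩ := exists_degree_decomposition x
  rw [map_add, map_add]
  refine add_mem (add_mem (h.even_lowerSpace hy u hu)
    (lowerSpace_mono (Nat.le_succ _) (h.degOne_lowerSpace hz u hu))) ?_
  have h3 := degNeg_lowerSpace hw u hu
  suffices hle : lowerSpace φ (n * (n - 1) / 2 + 1 + 1) ≤ lowerSpace φ (n * (n - 1) / 2 + 1) from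
    hle h3
  refine Submodule.span_le.2 ?_
  rintro _ ⟨l, w, hl, hk, hw, rfl⟩
  rcases lt_or_ge (n * (n - 1) / 2) l.length with h4 | h4
  · rw [h.degNeg_prod_eq_zero h2 hl h4]
    exact zero_mem _
  · exact Submodule.subset_span ⟨l, w, hl, Nat.lt_succ_of_le h4, hw, rfl⟩

/-- The restriction of a representation to a stable subspace. -/
def restrictRep (φ : pn n F →ₗ[F] Module.End F R) (Y : Submodule F R)
    (hY : ∀ x, ∀ u ∈ Y, φ x u ∈ Y) : pn n F →ₗ[F] Module.End F Y where
  toFun x := (φ x).restrict (hY x)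
  map_add' x y := by ext u; simp
  map_smul' r x := by ext u; simp

theorem restrictRep_coe {Y : Submodule F R} (hY : ∀ x, ∀ u ∈ Y, φ x u ∈ Y) (x : pn n F) (u : Y) :
    (restrictRep φ Y hY x u : R) = φ x u := rfl

theorem restrictRep_pow_coe {Y : Submodule F R} (hY : ∀ x, ∀ u ∈ Y, φ x u ∈ Y) (x : pn n F)
    (k : ℕ) (u : Y) : ((restrictRep φ Y hY x ^ k) u : R) = (φ x ^ k) u := by
  induction k with
  | zero => rfl
  | succ k ih => rw [pow_succ', pow_succ', Module.End.mul_apply, restrictRep_coe, ih]; rfl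

theorem restrictRep_list_coe {Y : Submodule F R} (hY : ∀ x, ∀ u ∈ Y, φ x u ∈ Y)
    (l : List (pn n F)) (u : Y) :
    (((l.map (restrictRep φ Y hY)).prod u : Y) : R) = (l.map φ).prod u := by
  induction l with
  | nil => rfl
  | cons x l ih =>
    rw [List.map_cons, List.prod_cons, Module.End.mul_apply, restrictRep_coe, ih]; rfl

theorem IsRep.restrict (h : IsRep p φ) {Y : Submodule F R} (hY : ∀ x, ∀ u ∈ Y, φ x u ∈ Y) :
    IsRep p (restrictRep φ Y hY) where
  bracket i j x y hx hy := by
    ext u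
    have := LinearMap.congr_fun (h.bracket i j x y hx hy) u
    simpa [restrictRep_coe] using this
  pPower x hx := by
    ext u
    rw [restrictRep_pow_coe, h.pPower, restrictRep_coe]

end Truncation

/-! ### Passage to ū-modules -/

section UbarModules

universe u

variable {F : Type u} [Field F] {p : ℕ} [Fact p.Prime] [CharP F p] {n : ℕ}

/-- For a simple root and a restricted weight, there is a ū-module with a singular vector of that
weight on which the first p - 1 powers of the negative root vector do not vanish. -/
theorem exists_ubar_isSingular (h2 : (2 : F) ≠ 0) {lam : Fin n → F} (hl : IsRestricted p lam)
    (i : ℕ) (hi : i + 1 < n) :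
    ∃ (V : Type u) (_ : AddCommGroup V) (_ : Module F V) (Φ : Ubar F p n →ₐ[F] Module.End F V)
      (v : V), IsSingular (fun x => Φ (ι F p n x)) lam v ∧
        ∀ j < p, (Φ (ι F p n (simpleNeg F i hi)) ^ j) v ≠ 0 := by
  obtain ⟨R, _, _, φ, v, hφ, hv, hne⟩ := exists_isSingular hl i hi
  have hY := hφ.lowerSpace_stable h2
  have hvY : v ∈ lowerSpace φ (n * (n - 1) / 2 + 1) :=
    topSpace_le (Nat.succ_pos _) fun b hb => hv.pos b (.inr hb)
  -- Each element of degree 1 lowers the filtration index, which starts at n(n-1)/2 + 1. With more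
  -- than n(n-1)/2 factors it reaches 0, and the zero space.
  obtain ⟨Φ, hΦ⟩ := (hφ.restrict hY).exists_lift fun l hl hlen => by
    ext u
    rw [restrictRep_list_coe]
    have := hφ.degOne_list hl u.2
    rw [show n * (n - 1) / 2 + 1 - l.length = 0 by omega, lowerSpace_zero] at this
    exact this
  refine ⟨_, _, _, Φ, ⟨v, hvY⟩, ⟨fun h0 => hv.ne_zero (congrArg Subtype.val h0), fun x hx => ?_,
    fun x => ?_⟩, fun j hj h0 => hne j hj ?_⟩
  · rw [hΦ]
    exact Subtype.ext (hv.pos x hx)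
  · rw [hΦ]
    exact Subtype.ext (hv.weight x)
  · rw [hΦ] at h0
    have := congrArg Subtype.val h0
    rwa [restrictRep_pow_coe] at this

end UbarModules

/-! ### The principal grading and its one-parameter torus -/

section GradingTorus

variable {F : Type*} [Field F] {n : ℕ}

/-- The degrees of the natural basis vectors under the principal grading. -/
def basisDegree : Fin n ⊕ Fin n → ℤ
  | .inl i => (n - i : ℕ)
  | .inr i => -((n - i : ℕ) : ℤ)

/-- The component of degree k of an element of p(n) under the principal grading. -/
def gradedPart (k : ℤ) (x : pn n F) : pn n F :=
  ⟨Matrix.of fun α β => if basisDegree α - basisDegree β = k then (x : Mat n F) α β else 0, by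
    obtain ⟨x, a, b, c, hb, hc, rfl⟩ := x
    refine ⟨Matrix.of fun i j => if basisDegree (.inl i) - basisDegree (.inl j) = k then a i j else 0,
      Matrix.of fun i j => if basisDegree (.inl i) - basisDegree (.inr j) = k then b i j else 0,
      Matrix.of fun i j => if basisDegree (.inr i) - basisDegree (.inl j) = k then c i j else 0,
      ?_, ?_, ?_⟩
    · ext i j
      have h : b j i = b i j := congrFun₂ hb i j
      have e : basisDegree (.inl j) - basisDegree (.inr i)
          = basisDegree (.inl i) - basisDegree (.inr j) := by simp only [basisDegree]; ring
      simp only [transpose_apply, of_apply, e, h]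
    · ext i j
      have h : c j i = - c i j := congrFun₂ hc i j
      have e : basisDegree (.inr j) - basisDegree (.inl i)
          = basisDegree (.inr i) - basisDegree (.inl j) := by simp only [basisDegree]; ring
      simp only [transpose_apply, of_apply, e, h, Matrix.neg_apply]
      split_ifs <;> simp
    · ext α β
      rcases α with i | i <;> rcases β with j | j
      · simp
      · simp
      · simp
      · have e : basisDegree (.inr i) - basisDegree (.inr j)
            = basisDegree (.inl j) - basisDegree (.inl i) := by simp only [basisDegree]; ring
        simp only [of_apply, fromBlocks_apply₂₂, Matrix.neg_apply, transpose_apply, e]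
        split_ifs <;> simp⟩

theorem gradedPart_apply (k : ℤ) (x : pn n F) (α β : Fin n ⊕ Fin n) :
    (gradedPart k x : Mat n F) α β =
      if basisDegree α - basisDegree β = k then (x : Mat n F) α β else 0 := rfl

theorem basisDegree_bounds (α : Fin n ⊕ Fin n) : -n ≤ basisDegree α ∧ basisDegree α ≤ n := by
  rcases α with i | i <;> simp only [basisDegree] <;> omega

theorem sum_gradedPart (x : pn n F) :
    x = ∑ k ∈ Finset.Icc (-(2 * n : ℤ)) (2 * n), gradedPart k x := by
  ext α β
  rw [AddSubmonoidClass.coe_finsetSum, Matrix.sum_apply]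
  simp only [gradedPart_apply]
  rw [Finset.sum_ite_eq, if_pos]
  have h1 := basisDegree_bounds α
  have h2 := basisDegree_bounds β
  rw [Finset.mem_Icc]
  omega

theorem gradedPart_parity (k : ℤ) {i : ZMod 2} {x : pn n F} (hx : HasParity i x) :
    HasParity i (gradedPart k x) := by
  unfold HasParity at hx ⊢
  split_ifs at hx ⊢
  · refine ⟨Matrix.ext fun a b => ?_, Matrix.ext fun a b => ?_⟩
    · have := congrFun₂ hx.1 a b
      simp only [toBlocks₁₂, of_apply, Matrix.zero_apply] at this
      simp [toBlocks₁₂, gradedPart_apply, this]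
    · have := congrFun₂ hx.2 a b
      simp only [toBlocks₂₁, of_apply, Matrix.zero_apply] at this
      simp [toBlocks₂₁, gradedPart_apply, this]
  · refine Matrix.ext fun a b => ?_
    have := congrFun₂ hx a b
    simp only [toBlocks₁₁, of_apply, Matrix.zero_apply] at this
    simp [toBlocks₁₁, gradedPart_apply, this]

theorem basisDegree_inl_sub (a b : Fin n) :
    basisDegree (.inl a) - basisDegree (.inl b) = (b : ℤ) - a := by
  simp only [basisDegree]; omega

/-- The degrees n - i are distinct and positive on the even basis vectors and are negated on the odd
ones. So entries off the diagonal never have degree 0. -/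
theorem gradedPart_zero (x : pn n F) :
    gradedPart 0 x = cartanElt fun i => (x : Mat n F) (.inl i) (.inl i) := by
  rw [cartanElt_eq]
  ext α β
  rw [gradedPart_apply, evenElt_coe]
  have hne : ∀ i j : Fin n, i ≠ j → (i : ℕ) ≠ j := fun i j h hc => h (Fin.ext hc)
  rcases α with i | i <;> rcases β with j | j
  · rcases eq_or_ne i j with rfl | hij
    · simp
    · have h0 : ¬ basisDegree (.inl i) - basisDegree (.inl j) = 0 := by
        have := hne i j hij
        simp only [basisDegree]; omega
      rw [if_neg h0, fromBlocks_apply₁₁, diagonal_apply_ne _ hij]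
  · have h0 : ¬ basisDegree (.inl i) - basisDegree (.inr j) = 0 := by
      simp only [basisDegree]; omega
    rw [if_neg h0]; rfl
  · have h0 : ¬ basisDegree (.inr i) - basisDegree (.inl j) = 0 := by
      simp only [basisDegree]; omega
    rw [if_neg h0]; rfl
  · rcases eq_or_ne i j with rfl | hij
    · obtain ⟨x, a, b, c, hb, hc, rfl⟩ := x
      simp
    · have h0 : ¬ basisDegree (.inr i) - basisDegree (.inr j) = 0 := by
        have := hne i j hij
        simp only [basisDegree]; omega
      rw [if_neg h0, fromBlocks_apply₂₂, diagonal_transpose, Matrix.neg_apply,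
        diagonal_apply_ne _ hij, neg_zero]

/-- The (a, b) entry of the upper left block has degree b - a, so positive degree means strictly
upper triangular. Entries of the lower left block have negative degree, so an odd element of
positive degree lies in 𝔤₁. -/
theorem gradedPart_pos {k : ℤ} (hk : 0 < k) {i : ZMod 2} {x : pn n F} (hx : HasParity i x) :
    IsEvenPos (gradedPart k x) ∨ IsDegOne (gradedPart k x) := by
  have h2 : ∀ k : ZMod 2, k = 0 ∨ k = 1 := by decide
  have hg := gradedPart_parity k hx
  rcases h2 i with rfl | rfl
  · refine .inl ⟨hg, fun a b hab => ?_⟩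
    simp only [toBlocks₁₁, of_apply, gradedPart_apply, basisDegree_inl_sub]
    rw [if_neg]
    have : (b : ℕ) ≤ a := hab
    omega
  · refine .inr ⟨hg, Matrix.ext fun a b => ?_⟩
    have h0 : ¬ basisDegree (.inr a) - basisDegree (.inl b) = k := by
      simp only [basisDegree]; omega
    simp only [toBlocks₂₁, of_apply, gradedPart_apply, Matrix.zero_apply, if_neg h0]

/-- The one-parameter torus that defines the principal grading. -/
def gradingTorus (n : ℕ) (s : Fˣ) : GL (Fin n) F where
  val := diagonal fun i => (s : F) ^ (n - i : ℕ)
  inv := diagonal fun i => ((s⁻¹ : Fˣ) : F) ^ (n - i : ℕ)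
  val_inv := by simp
  inv_val := by simp

theorem gradingTorus_isDiag (s : Fˣ) : (gradingTorus n s : Matrix (Fin n) (Fin n) F).IsDiag :=
  isDiag_diagonal _

theorem rho_gradingTorus (s : Fˣ) :
    rho (gradingTorus n s) = diagonal fun α => ((s ^ basisDegree α : Fˣ) : F) := by
  have h1 : ((gradingTorus n s)⁻¹).1 = diagonal fun i : Fin n => ((s⁻¹ : Fˣ) : F) ^ (n - i : ℕ) :=
    rfl
  have h2 : (gradingTorus n s).1 = diagonal fun i : Fin n => (s : F) ^ (n - i : ℕ) := rfl
  rw [rho, h1, h2, diagonal_transpose, fromBlocks_diagonal]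
  congr 1
  funext α
  rcases α with i | i <;> simp [basisDegree, -Nat.cast_sub]

theorem rho_gradingTorus_inv (s : Fˣ) :
    rho (gradingTorus n s)⁻¹ = diagonal fun α => ((s ^ (-basisDegree α) : Fˣ) : F) := by
  have : (gradingTorus n s)⁻¹ = gradingTorus n s⁻¹ := by
    ext1; rfl
  rw [this, rho_gradingTorus]
  simp

theorem Ad_gradingTorus (s : Fˣ) (x : pn n F) (α β : Fin n ⊕ Fin n) :
    (Ad (gradingTorus n s) x : Mat n F) α β =
      ((s ^ (basisDegree α - basisDegree β) : Fˣ) : F) * (x : Mat n F) α β := by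
  change (rho (gradingTorus n s) * (x : Mat n F) * rho (gradingTorus n s)⁻¹ : Mat n F) α β = _
  rw [rho_gradingTorus, rho_gradingTorus_inv, mul_diagonal, diagonal_mul, sub_eq_add_neg, _root_.zpow_add,
    Units.val_mul]
  ring

theorem Ad_gradedPart (s : Fˣ) (k : ℤ) (x : pn n F) :
    Ad (gradingTorus n s) (gradedPart k x) = ((s ^ k : Fˣ) : F) • gradedPart k x := by
  ext α β
  rw [Ad_gradingTorus]
  change _ = ((s ^ k : Fˣ) : F) * (gradedPart k x : Mat n F) α β
  rw [gradedPart_apply]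
  split_ifs with h
  · rw [h]
  · simp

theorem Ad_gradingTorus_pos (s : Fˣ) {x : pn n F} (hx : IsEvenPos x ∨ IsDegOne x) :
    IsEvenPos (Ad (gradingTorus n s) x) ∨ IsDegOne (Ad (gradingTorus n s) x) := by
  rcases hx with hx | hx
  · refine .inl ⟨Ad_parity _ hx.1, fun i j hij => ?_⟩
    have := hx.2 i j hij
    simp only [toBlocks₁₁, of_apply] at this ⊢
    rw [Ad_gradingTorus, this, mul_zero]
  · exact .inr (Ad_degOne _ hx)

end GradingTorus

/-! ### Brackets of 𝔫⁺ with the Cartan subalgebra -/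

section Brackets

variable {F : Type*} [Field F] {n : ℕ}

theorem bracket_add_right (x y z : pn n F) :
    bracket x (y + z) = bracket x y + bracket x z := by
  ext1
  have h : oddPart ((y : Mat n F) + (z : Mat n F)) = oddPart (y : Mat n F) + oddPart (z : Mat n F) := by
    ext α β
    rcases α with i | i <;> rcases β with j | j <;> simp [oddPart, toBlocks₁₂, toBlocks₂₁]
  change superComm (x : Mat n F) ((y : Mat n F) + (z : Mat n F)) =
    superComm (x : Mat n F) (y : Mat n F) + superComm (x : Mat n F) (z : Mat n F)
  simp only [superComm, h, Matrix.mul_add, Matrix.add_mul, smul_add]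
  abel

theorem bracket_pos_cartan {x : pn n F} (hx : IsEvenPos x ∨ IsDegOne x) (h : Fin n → F) :
    IsEvenPos (bracket x (cartanElt h)) ∨ IsDegOne (bracket x (cartanElt h)) := by
  rcases hx with hx | hx
  · left
    rw [eq_evenElt hx.1, cartanElt_eq, bracket_evenElt]
    refine ⟨evenElt_parity _, fun i j hij => ?_⟩
    rw [evenElt_coe, toBlocks_fromBlocks₁₁, Matrix.sub_apply, mul_diagonal, diagonal_mul,
      hx.2 i j hij]
    simp
  · exact .inr (bracket_degOne_even hx (cartanElt_parity h))

theorem IsEvenPos.exists_parity {x : pn n F} (hx : IsEvenPos x ∨ IsDegOne x) :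
    ∃ i, HasParity i x := by
  rcases hx with hx | hx
  · exact ⟨0, hx.1⟩
  · exact ⟨1, hx.hasParity⟩

end Brackets

/-! ### Triangular decomposition of ū and of its torus invariants -/

section Decomposition

variable {F : Type*} [Field F] {p : ℕ} [Fact p.Prime] [CharP F p] {n : ℕ}

theorem ι_swap {i j : ZMod 2} {x y : pn n F} (hx : HasParity i x) (hy : HasParity j y) :
    ι F p n x * ι F p n y = koszul F i j • (ι F p n y * ι F p n x) + ι F p n (bracket x y) := by
  rw [← ι_bracket hx hy]; abel

theorem cartanMap_ιh (x : Fin n → F) : cartanMap F p n (ιh F p n x) = ι F p n (cartanElt x) :=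
  liftUh_ιh p _ _ _ x

/-- The Cartan subalgebra normalises 𝔫⁺: for x in 𝔫⁺ one has xh = hx + [x, h] with [x, h] in 𝔫⁺. -/
theorem mul_cartanMap_mem {u : Ubar F p n} (hu : u ∈ leftIdealPos F n p) (f : Uh F p n) :
    u * cartanMap F p n f ∈ leftIdealPos F n p := by
  induction f using uh_induction generalizing u with
  | scalar r =>
    rw [AlgHom.commutes, ← Algebra.commutes]
    exact Ideal.mul_mem_left _ _ hu
  | gen h =>
    rw [cartanMap_ιh]
    refine Submodule.span_induction ?_ ?_ ?_ ?_ hu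
    · rintro _ ⟨x, hx, rfl⟩
      obtain ⟨i, hi⟩ := IsEvenPos.exists_parity hx
      rw [ι_swap hi (cartanElt_parity h), Algebra.smul_def, ← mul_assoc]
      exact add_mem (Ideal.mul_mem_left _ _ (Ideal.subset_span ⟨x, hx, rfl⟩))
        (Ideal.subset_span ⟨_, bracket_pos_cartan hx h, rfl⟩)
    · rw [zero_mul]; exact zero_mem _
    · intro a b _ _ ha hb
      rw [add_mul]; exact add_mem ha hb
    · intro a b _ hb
      rw [smul_eq_mul, mul_assoc]
      exact Ideal.mul_mem_left _ _ hb
  | mul a b ha hb => rw [map_mul, ← mul_assoc]; exact hb (ha hu)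
  | add a b ha hb => rw [map_add, mul_add]; exact add_mem (ha hu) (hb hu)

variable (F n) in
/-- Homogeneous elements of p(n) that have negative degree under the principal grading. -/
def IsNegRoot (y : pn n F) : Prop :=
  (∃ i, HasParity i y) ∧ ∃ r : ℕ, 0 < r ∧
    ∀ s : Fˣ, Ad (gradingTorus n s) y = ((s⁻¹ ^ r : Fˣ) : F) • y

variable (F p n) in
/-- The span of the products of negative root vectors and elements of u(𝔥), plus ū𝔫⁺. -/
def triangularSpan : Submodule F (Ubar F p n) :=
  Submodule.span F {u | ∃ (l : List (pn n F)) (f : Uh F p n), (∀ y ∈ l, IsNegRoot F n y) ∧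
    u = (l.map (ι F p n)).prod * cartanMap F p n f} ⊔ (leftIdealPos F n p).restrictScalars F

theorem neg_mul_triangularSpan {y : pn n F} (hy : IsNegRoot F n y) {u : Ubar F p n}
    (hu : u ∈ triangularSpan F p n) : ι F p n y * u ∈ triangularSpan F p n := by
  suffices h : triangularSpan F p n ≤
      (triangularSpan F p n).comap (LinearMap.mulLeft F (ι F p n y)) from h hu
  refine sup_le (Submodule.span_le.2 ?_) fun u hu =>
    Submodule.mem_sup_right (Ideal.mul_mem_left _ _ hu)
  rintro _ ⟨l, f, hl, rfl⟩
  refine Submodule.mem_sup_left (Submodule.subset_span ⟨y :: l, f, List.forall_mem_cons.2 ⟨hy, hl⟩, ?_⟩)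
  simp [mul_assoc]

theorem pos_mul_cartanMap {x : pn n F} (hx : IsEvenPos x ∨ IsDegOne x) (f : Uh F p n) :
    ι F p n x * cartanMap F p n f ∈ triangularSpan F p n :=
  Submodule.mem_sup_right (mul_cartanMap_mem (Ideal.subset_span ⟨x, hx, rfl⟩) f)

/-- Splitting x by principal degree gives negative root vectors, an element of 𝔥 that is absorbed
into f, and elements of 𝔫⁺ that put the product into ū𝔫⁺. -/
theorem ι_mul_cartanMap_of_parity {i : ZMod 2} {x : pn n F} (hx : HasParity i x) (f : Uh F p n) :
    ι F p n x * cartanMap F p n f ∈ triangularSpan F p n := by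
  rw [sum_gradedPart x, map_sum, Finset.sum_mul]
  refine sum_mem fun k _ => ?_
  rcases lt_trichotomy k 0 with hk | rfl | hk
  · have : IsNegRoot F n (gradedPart k x) := by
      refine ⟨⟨i, gradedPart_parity k hx⟩, k.natAbs, by omega, fun s => ?_⟩
      rw [Ad_gradedPart]
      congr 2
      rw [← zpow_natCast, _root_.inv_zpow, ← _root_.zpow_neg]
      congr 1
      omega
    exact Submodule.mem_sup_left (Submodule.subset_span ⟨[gradedPart k x], f, by simpa using this,
      by simp⟩)
  · rw [gradedPart_zero]
    refine Submodule.mem_sup_left (Submodule.subset_span ⟨[],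
      ιh F p n (fun i => (x : Mat n F) (.inl i) (.inl i)) * f, by simp, ?_⟩)
    rw [map_mul, List.map_nil, List.prod_nil, one_mul]
    rw [cartanMap_ιh]
  · exact pos_mul_cartanMap (gradedPart_pos hk hx) f

theorem degree_induction {C : pn n F → Prop} (h : ∀ i x, HasParity i x → C x)
    (hadd : ∀ x y, C x → C y → C (x + y)) (x : pn n F) : C x := by
  obtain ⟨y, z, w, hy, hz, hw, rfl⟩ := exists_degree_decomposition x
  exact hadd _ _ (hadd _ _ (h 0 y hy) (h 1 z hz.hasParity)) (h 1 w (degNeg_parity hw))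

/-- Moving x past the first negative root vector leaves two terms with a shorter list, one with x
and one with a bracket. The bracket need not be homogeneous for the principal grading, so the
induction on the list runs over all x. -/
theorem ι_mul_prod_mem {l : List (pn n F)} (hl : ∀ y ∈ l, IsNegRoot F n y) (f : Uh F p n)
    (x : pn n F) :
    ι F p n x * ((l.map (ι F p n)).prod * cartanMap F p n f) ∈ triangularSpan F p n := by
  induction l generalizing x with
  | nil =>
    rw [List.map_nil, List.prod_nil, one_mul]
    induction x using degree_induction with
    | h i x hx => exact ι_mul_cartanMap_of_parity hx f
    | hadd x y hx hy => rw [map_add, add_mul]; exact add_mem hx hy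
  | cons y l ih =>
    have hy := hl y (by simp)
    have ih := ih fun z hz => hl z (by simp [hz])
    induction x using degree_induction with
    | h i x hx =>
      obtain ⟨j, hj⟩ := hy.1
      rw [List.map_cons, List.prod_cons, mul_assoc, ← mul_assoc, ι_swap hx hj, add_mul,
        smul_mul_assoc, mul_assoc]
      exact add_mem (Submodule.smul_mem _ _ (neg_mul_triangularSpan hy (ih x))) (ih _)
    | hadd x z hx hz => rw [map_add, add_mul]; exact add_mem hx hz

theorem ι_mul_triangularSpan (x : pn n F) {u : Ubar F p n} (hu : u ∈ triangularSpan F p n) :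
    ι F p n x * u ∈ triangularSpan F p n := by
  suffices h : triangularSpan F p n ≤
      (triangularSpan F p n).comap (LinearMap.mulLeft F (ι F p n x)) from h hu
  refine sup_le (Submodule.span_le.2 ?_) fun u hu =>
    Submodule.mem_sup_right (Ideal.mul_mem_left _ _ hu)
  rintro _ ⟨l, f, hl, rfl⟩
  exact ι_mul_prod_mem hl f x

theorem triangularSpan_eq_top : triangularSpan F p n = ⊤ := by
  suffices h : ∀ (u : Ubar F p n), ∀ w ∈ triangularSpan F p n, u * w ∈ triangularSpan F p n from
    eq_top_iff.2 fun u _ => by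
      simpa using h u 1 (Submodule.mem_sup_left (Submodule.subset_span ⟨[], 1, by simp, by simp⟩))
  intro u
  induction u using ubar_induction with
  | scalar r => exact fun w hw => by rw [← Algebra.smul_def]; exact Submodule.smul_mem _ _ hw
  | gen x => exact fun w hw => ι_mul_triangularSpan x hw
  | mul a b ha hb => exact fun w hw => by rw [mul_assoc]; exact ha _ (hb _ hw)
  | add a b ha hb => exact fun w hw => by rw [add_mul]; exact add_mem (ha _ hw) (hb _ hw)

variable (F p n) in
/-- The span of the vectors of negative degree in ū under the principal grading. -/
def negSpan : Submodule F (Ubar F p n) :=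
  Submodule.span F {u | ∃ r : ℕ, 0 < r ∧
    ∀ s : Fˣ, act p (gradingTorus n s) u = ((s⁻¹ ^ r : Fˣ) : F) • u}

theorem prod_mem_negSpan {l : List (pn n F)} (hl : ∀ y ∈ l, IsNegRoot F n y) (hne : l ≠ [])
    (f : Uh F p n) : (l.map (ι F p n)).prod * cartanMap F p n f ∈ negSpan F p n := by
  suffices h : ∃ r : ℕ, (l ≠ [] → 0 < r) ∧ ∀ s : Fˣ, act p (gradingTorus n s)
      ((l.map (ι F p n)).prod * cartanMap F p n f) = ((s⁻¹ ^ r : Fˣ) : F) •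
        ((l.map (ι F p n)).prod * cartanMap F p n f) by
    obtain ⟨r, hr, h⟩ := h
    exact Submodule.subset_span ⟨r, hr hne, h⟩
  clear hne
  induction l with
  | nil =>
    refine ⟨0, by simp, fun s => ?_⟩
    simp [cartanMap_mem F p n f _ (gradingTorus_isDiag s)]
  | cons y l ih =>
    obtain ⟨r, -, h⟩ := ih fun z hz => hl z (by simp [hz])
    obtain ⟨-, q, hq, hy⟩ := hl y (by simp)
    refine ⟨q + r, fun _ => by omega, fun s => ?_⟩
    rw [List.map_cons, List.prod_cons, mul_assoc, map_mul, h, act_ι, hy, map_smul,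
      smul_mul_smul_comm, pow_add, Units.val_mul]

theorem exists_decomposition (u : Ubar F p n) : ∃ (f : Uh F p n) (a j : Ubar F p n),
    a ∈ negSpan F p n ∧ j ∈ leftIdealPos F n p ∧ u = cartanMap F p n f + a + j := by
  have hu : u ∈ triangularSpan F p n := by rw [triangularSpan_eq_top]; trivial
  obtain ⟨w, hw, j, hj, rfl⟩ := Submodule.mem_sup.1 hu
  suffices h : ∃ (f : Uh F p n) (a : Ubar F p n), a ∈ negSpan F p n ∧ w = cartanMap F p n f + a by
    obtain ⟨f, a, ha, rfl⟩ := h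
    exact ⟨f, a, j, ha, hj, rfl⟩
  induction hw using Submodule.span_induction with
  | mem w h =>
    obtain ⟨l, f, hl, rfl⟩ := h
    rcases eq_or_ne l [] with rfl | hne
    · exact ⟨f, 0, zero_mem _, by simp⟩
    · exact ⟨0, _, prod_mem_negSpan hl hne f, by simp⟩
  | zero => exact ⟨0, 0, zero_mem _, by simp⟩
  | add w w' _ _ h h' =>
    obtain ⟨f, a, ha, rfl⟩ := h (by rw [triangularSpan_eq_top]; trivial)
    obtain ⟨f', a', ha', rfl⟩ := h' (by rw [triangularSpan_eq_top]; trivial)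
    exact ⟨f + f', a + a', add_mem ha ha', by rw [map_add]; abel⟩
  | smul r w _ h =>
    obtain ⟨f, a, ha, rfl⟩ := h (by rw [triangularSpan_eq_top]; trivial)
    exact ⟨r • f, r • a, Submodule.smul_mem _ _ ha, by rw [map_smul, smul_add]⟩

theorem act_leftIdealPos (s : Fˣ) {u : Ubar F p n} (hu : u ∈ leftIdealPos F n p) :
    act p (gradingTorus n s) u ∈ leftIdealPos F n p := by
  refine Submodule.span_induction ?_ ?_ ?_ ?_ hu
  · rintro _ ⟨x, hx, rfl⟩
    rw [act_ι]
    exact Ideal.subset_span ⟨_, Ad_gradingTorus_pos s hx, rfl⟩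
  · rw [map_zero]; exact zero_mem _
  · intro a b _ _ ha hb
    rw [map_add]; exact add_mem ha hb
  · intro a b _ hb
    rw [smul_eq_mul, map_mul]
    exact Ideal.mul_mem_left _ _ hb

theorem aeval_mem_of_stable {V : Type*} [AddCommGroup V] [Module F V] {T : Module.End F V}
    {Y : Submodule F V} (hY : ∀ v ∈ Y, T v ∈ Y) (q : Polynomial F) {v : V} (hv : v ∈ Y) :
    Polynomial.aeval T q v ∈ Y := by
  induction q using Polynomial.induction_on' generalizing v with
  | add q r hq hr => rw [map_add]; exact add_mem (hq hv) (hr hv)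
  | monomial k c =>
    rw [Polynomial.aeval_monomial, Module.End.mul_apply, Module.algebraMap_end_apply]
    refine Submodule.smul_mem _ _ ?_
    induction k with
    | zero => exact hv
    | succ k ih => rw [pow_succ', Module.End.mul_apply]; exact hY _ ih

theorem aeval_apply_of_eigen {V : Type*} [AddCommGroup V] [Module F V] {T : Module.End F V}
    {c : F} {v : V} (hv : T v = c • v) (q : Polynomial F) :
    Polynomial.aeval T q v = q.eval c • v := by
  induction q using Polynomial.induction_on' with
  | add q r hq hr => rw [map_add, LinearMap.add_apply, hq, hr, Polynomial.eval_add, add_smul]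
  | monomial k a =>
    rw [Polynomial.aeval_monomial, Module.End.mul_apply, Module.algebraMap_end_apply,
      Polynomial.eval_monomial, mul_smul]
    congr 1
    induction k with
    | zero => simp
    | succ k ih => rw [pow_succ', Module.End.mul_apply, ih, map_smul, hv, smul_smul, pow_succ]

/-- On a summand with eigenvalue s^(-r) the normalised linear polynomial (X - s^(-r)) / (1 - s^(-r))
does the job, and for sums one multiplies. Taking R as the product of the exponents ensures that s^R
≠ 1 keeps all the denominators nonzero. -/
theorem negSpan_annihilator {a : Ubar F p n} (ha : a ∈ negSpan F p n) : ∃ R : ℕ, 0 < R ∧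
    ∀ s : Fˣ, s ^ R ≠ 1 → ∃ q : Polynomial F, q.eval 1 = 1 ∧
      Polynomial.aeval (act p (gradingTorus n s)).toLinearMap q a = 0 := by
  induction ha using Submodule.span_induction with
  | mem a h =>
    obtain ⟨r, hr, h⟩ := h
    refine ⟨r, hr, fun s hs => ?_⟩
    have hs' : 1 - ((s⁻¹ ^ r : Fˣ) : F) ≠ 0 := by
      rw [sub_ne_zero]
      intro hc
      rw [← Units.val_one, Units.val_inj, inv_pow, eq_comm, inv_eq_one] at hc
      exact hs hc
    refine ⟨Polynomial.C (1 - ((s⁻¹ ^ r : Fˣ) : F))⁻¹ *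
      (Polynomial.X - Polynomial.C ((s⁻¹ ^ r : Fˣ) : F)), ?_, ?_⟩
    · simp only [Polynomial.eval_mul, Polynomial.eval_C, Polynomial.eval_sub, Polynomial.eval_X]
      exact inv_mul_cancel₀ hs'
    · rw [aeval_apply_of_eigen (h s)]
      simp
  | zero => exact ⟨1, one_pos, fun s _ => ⟨1, by simp, by simp⟩⟩
  | add a b _ _ ha hb =>
    obtain ⟨R, hR, ha⟩ := ha
    obtain ⟨R', hR', hb⟩ := hb
    refine ⟨R * R', Nat.mul_pos hR hR', fun s hs => ?_⟩
    obtain ⟨q, hq, ha⟩ := ha s fun hc => hs (by rw [pow_mul, hc, one_pow])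
    obtain ⟨q', hq', hb⟩ := hb s fun hc => hs (by rw [mul_comm, pow_mul, hc, one_pow])
    refine ⟨q * q', by simp [hq, hq'], ?_⟩
    rw [map_add, map_mul, Module.End.mul_apply, Module.End.mul_apply, hb, map_zero, add_zero,
      ← Module.End.mul_apply, ← map_mul, mul_comm, map_mul, Module.End.mul_apply, ha, map_zero]
  | smul c a _ ha =>
    obtain ⟨R, hR, ha⟩ := ha
    refine ⟨R, hR, fun s hs => ?_⟩
    obtain ⟨q, hq, ha⟩ := ha s hs
    exact ⟨q, hq, by rw [map_smul, ha, smul_zero]⟩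

theorem exists_unit_pow_ne_one [Infinite F] {R : ℕ} (hR : 0 < R) : ∃ s : Fˣ, s ^ R ≠ 1 := by
  by_contra! h
  have h0 : (Polynomial.X * (Polynomial.X ^ R - 1) : Polynomial F) = 0 := by
    refine Polynomial.funext fun s => ?_
    rcases eq_or_ne s 0 with rfl | hs
    · simp
    · have := congrArg Units.val (h (Units.mk0 s hs))
      rw [Units.val_pow_eq_pow_val, Units.val_mk0, Units.val_one] at this
      simp [this]
  rcases mul_eq_zero.1 h0 with h1 | h1
  · exact Polynomial.X_ne_zero h1
  · exact (Polynomial.monic_X_pow_sub_C (1 : F) hR.ne').ne_zero (by simpa using h1)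

/-- The algebra of torus invariants is the sum of u(𝔥) and 𝔩. -/
theorem exists_sub_cartanMap_mem [Infinite F] {u : Ubar F p n} (hu : u ∈ torusInv F n p) :
    ∃ f, u - cartanMap F p n f ∈ leftIdealPos F n p := by
  obtain ⟨f, a, j, ha, hj, e⟩ := exists_decomposition u
  obtain ⟨R, hR, ha⟩ := negSpan_annihilator ha
  obtain ⟨s, hs⟩ := exists_unit_pow_ne_one (F := F) hR
  obtain ⟨q, hq, ha⟩ := ha s hs
  refine ⟨f, ?_⟩
  -- The difference u - f is torus-fixed, so q of the torus action multiplies it by q(1) = 1. The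
  -- same operator kills a and preserves the left ideal, which leaves an element of ū𝔫⁺.
  have hfix : (act p (gradingTorus n s)).toLinearMap (u - cartanMap F p n f)
      = (1 : F) • (u - cartanMap F p n f) := by
    rw [AlgHom.toLinearMap_apply, map_sub, hu _ (gradingTorus_isDiag s),
      cartanMap_mem F p n f _ (gradingTorus_isDiag s), one_smul]
  have h1 := aeval_apply_of_eigen hfix q
  rw [hq, one_smul] at h1
  rw [← h1, e, show cartanMap F p n f + a + j - cartanMap F p n f = a + j by abel, map_add, ha,
    zero_add]
  exact aeval_mem_of_stable (Y := (leftIdealPos F n p).restrictScalars F)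
    (fun v hv => act_leftIdealPos s hv) q hj

end Decomposition

/-! ### Invariants of GL(n) commute with even root vectors -/

section InvariantsCommute

variable {F : Type*} [Field F] {p : ℕ} [Fact p.Prime] [CharP F p] {n : ℕ}

theorem ι_even_bracket {y : pn n F} (hy : HasParity 0 y) (x : pn n F) :
    ι F p n y * ι F p n x - ι F p n x * ι F p n y = ι F p n (bracket y x) := by
  induction x using degree_induction with
  | h i x hx =>
    have := ι_bracket (p := p) hy hx
    simpa [koszul] using this
  | hadd x z hx hz =>
    rw [bracket_add_right, map_add, map_add, ← hx, ← hz, mul_add, add_mul]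
    abel

theorem bracket_even_coe {y : pn n F} (hy : HasParity 0 y) (x : pn n F) :
    (bracket y x : Mat n F) = (y : Mat n F) * (x : Mat n F) - (x : Mat n F) * (y : Mat n F) := by
  obtain ⟨a, ha⟩ := even_eq hy
  change superComm (y : Mat n F) (x : Mat n F) = _
  simp [superComm, oddPart, ha]

/-- The transvection 1 + sE for a matrix E of square zero. -/
def transvectionElt {E : Matrix (Fin n) (Fin n) F} (hE : E * E = 0) (s : F) : GL (Fin n) F where
  val := 1 + s • E
  inv := 1 - s • E
  val_inv := by simp [Matrix.mul_sub, Matrix.add_mul, hE]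
  inv_val := by simp [Matrix.mul_add, Matrix.sub_mul, hE]

theorem rho_transvectionElt {E : Matrix (Fin n) (Fin n) F} (hE : E * E = 0) (s : F) :
    rho (transvectionElt hE s) = 1 + s • (evenElt E : Mat n F) := by
  have h1 : ((transvectionElt hE s)⁻¹).1 = 1 - s • E := rfl
  have h2 : (transvectionElt hE s).1 = 1 + s • E := rfl
  rw [rho, h1, h2, evenElt_coe, fromBlocks_smul, ← fromBlocks_one, fromBlocks_add]
  congr 1 <;> simp [sub_eq_add_neg]

theorem rho_transvectionElt_inv {E : Matrix (Fin n) (Fin n) F} (hE : E * E = 0) (s : F) :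
    rho (transvectionElt hE s)⁻¹ = 1 - s • (evenElt E : Mat n F) := by
  have : (transvectionElt hE s)⁻¹ = transvectionElt hE (-s) := by
    ext1
    change 1 - s • E = 1 + (-s) • E
    rw [neg_smul, sub_eq_add_neg]
  rw [this, rho_transvectionElt, neg_smul, sub_eq_add_neg]

/-- Conjugation by 1 + sE with inverse 1 - sE is quadratic in s, and its linear term is the
commutator. The quadratic coefficient q lies in p(n) because it is obtained from the case s = 1. -/
theorem Ad_transvectionElt {E : Matrix (Fin n) (Fin n) F} (hE : E * E = 0) (x : pn n F) :
    ∃ q : pn n F, ∀ s : F, Ad (transvectionElt hE s) x = x + s • bracket (evenElt E) x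
      + (s * s) • q := by
  have h : ∀ s : F, (Ad (transvectionElt hE s) x : Mat n F) = (x : Mat n F)
      + s • ((evenElt E : Mat n F) * (x : Mat n F) - (x : Mat n F) * (evenElt E : Mat n F))
      + (s * s) • -((evenElt E : Mat n F) * (x : Mat n F) * (evenElt E : Mat n F)) := by
    intro s
    change rho (transvectionElt hE s) * (x : Mat n F) * rho (transvectionElt hE s)⁻¹ = _
    rw [rho_transvectionElt, rho_transvectionElt_inv]
    simp only [Matrix.add_mul, Matrix.mul_sub, Matrix.one_mul, Matrix.mul_one, Matrix.smul_mul,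
      Matrix.mul_smul, smul_sub, smul_neg, smul_smul, smul_add]
    abel
  refine ⟨Ad (transvectionElt hE 1) x - x - bracket (evenElt E) x, fun s => ?_⟩
  ext1
  have h1 := h 1
  rw [one_smul, one_mul, one_smul] at h1
  change (Ad (transvectionElt hE s) x : Mat n F) = (x : Mat n F)
    + s • (bracket (evenElt E) x : Mat n F) + (s * s) • ((Ad (transvectionElt hE 1) x : Mat n F)
      - (x : Mat n F) - (bracket (evenElt E) x : Mat n F))
  rw [bracket_even_coe (evenElt_parity E), h s, h1]
  congr 2
  abel

/-- The action of 1 + sE is polynomial in s with derivative ad E at s = 0: this holds on generators,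
and the Leibniz rule carries it to products. Evaluation is multiplicative here since the scalars s
are central. -/
theorem act_transvectionElt {E : Matrix (Fin n) (Fin n) F} (hE : E * E = 0) (u : Ubar F p n) :
    ∃ P : Polynomial (Ubar F p n), P.coeff 0 = u ∧
      P.coeff 1 = ι F p n (evenElt E) * u - u * ι F p n (evenElt E) ∧
      ∀ s : F, act p (transvectionElt hE s) u = P.eval (algebraMap F _ s) := by
  induction u using ubar_induction with
  | scalar r =>
    refine ⟨Polynomial.C (algebraMap F _ r), by simp, ?_, by simp⟩
    rw [← Algebra.commutes, sub_self, Polynomial.coeff_C_succ]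
  | gen x =>
    obtain ⟨q, hq⟩ := Ad_transvectionElt hE x
    refine ⟨Polynomial.C (ι F p n x) + Polynomial.C (ι F p n (bracket (evenElt E) x)) * Polynomial.X
      + Polynomial.C (ι F p n q) * Polynomial.X ^ 2, by simp, ?_, fun s => ?_⟩
    · rw [ι_even_bracket (evenElt_parity E)]
      simp [Polynomial.coeff_X_pow, Polynomial.coeff_C]
    · rw [act_ι, hq, ← pow_two]
      simp only [map_add, map_smul, Polynomial.eval_add, Polynomial.eval_C, Polynomial.eval_C_mul,
        Polynomial.eval_X, Polynomial.eval_X_pow, ← map_pow, ← Algebra.commutes s,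
        ← Algebra.commutes (s ^ 2), ← Algebra.smul_def]
  | mul a b ha hb =>
    obtain ⟨P, hP0, hP1, hP⟩ := ha
    obtain ⟨Q, hQ0, hQ1, hQ⟩ := hb
    refine ⟨P * Q, by rw [Polynomial.mul_coeff_zero, hP0, hQ0], ?_, fun s => ?_⟩
    · rw [Polynomial.mul_coeff_one, hP0, hP1, hQ0, hQ1]
      noncomm_ring
    · rw [map_mul, hP, hQ]
      exact (Polynomial.eval₂_mul_noncomm _ _ fun k => (Algebra.commutes s _).symm).symm
  | add a b ha hb =>
    obtain ⟨P, hP0, hP1, hP⟩ := ha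
    obtain ⟨Q, hQ0, hQ1, hQ⟩ := hb
    refine ⟨P + Q, by rw [Polynomial.coeff_add, hP0, hQ0], ?_, fun s => ?_⟩
    · rw [Polynomial.coeff_add, hP1, hQ1]
      noncomm_ring
    · rw [map_add, hP, hQ, Polynomial.eval_add]

/-- Linear functionals reduce this to polynomials over F, where a polynomial that is constant on an
infinite field is a constant. -/
theorem coeff_one_eq_zero_of_eval_eq [Infinite F] {A : Type*} [Ring A] [Algebra F A]
    {P : Polynomial A} {z : A} (h : ∀ s : F, P.eval (algebraMap F A s) = z) : P.coeff 1 = 0 := by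
  rw [← Module.forall_dual_apply_eq_zero_iff F]
  intro l
  let q : Polynomial F := ∑ k ∈ Finset.range (P.natDegree + 2), Polynomial.monomial k (l (P.coeff k))
  have hq : q = Polynomial.C (l z) := by
    refine Polynomial.funext fun s => ?_
    rw [Polynomial.eval_C, ← h s, Polynomial.eval_eq_sum_range' (show P.natDegree < P.natDegree + 2 by omega),
      map_sum, Polynomial.eval_finsetSum]
    refine Finset.sum_congr rfl fun k _ => ?_
    rw [Polynomial.eval_monomial, ← map_pow, ← Algebra.commutes, ← Algebra.smul_def, map_smul,
      smul_eq_mul, mul_comm]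
  have h1 : q.coeff 1 = l (P.coeff 1) := by
    simp [q, Polynomial.finsetSum_coeff, Polynomial.coeff_monomial]
  rw [← h1, hq, Polynomial.coeff_C_succ]

/-- The elements of ū fixed by GL(n) commute with the root vectors of the even part. -/
theorem commute_of_act_eq [Infinite F] {z : Ubar F p n}
    (hz : ∀ g : GL (Fin n) F, act p g z = z) {E : Matrix (Fin n) (Fin n) F} (hE : E * E = 0) :
    ι F p n (evenElt E) * z = z * ι F p n (evenElt E) := by
  obtain ⟨P, -, h1, hP⟩ := act_transvectionElt hE z
  rw [← sub_eq_zero, ← h1]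
  exact coeff_one_eq_zero_of_eval_eq fun s => by rw [← hP, hz]

end InvariantsCommute

/-! ### The 𝔰𝔩₂ computation and singular vectors of reflected weights -/

section Reflection

variable {F : Type*} [Field F] {p : ℕ} [Fact p.Prime] [CharP F p] {n : ℕ}
  {V : Type*} [AddCommGroup V] [Module F V] {φ : pn n F →ₗ[F] Module.End F V}

theorem koszul_zero_right (i : ZMod 2) : koszul F i 0 = 1 := by simp [koszul]

theorem simpleNeg_parity (i : ℕ) (hi : i + 1 < n) : HasParity 0 (simpleNeg F i hi) :=
  evenElt_parity _

theorem bracket_cartan_simpleNeg (i : ℕ) (hi : i + 1 < n) (x : Fin n → F) :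
    bracket (cartanElt x) (simpleNeg F i hi) =
      (x ⟨i + 1, hi⟩ - x ⟨i, by omega⟩) • simpleNeg F i hi := by
  rw [cartanElt_eq, simpleNeg, bracket_evenElt, ← map_smul]
  congr 1
  ext a b
  rw [Matrix.sub_apply, diagonal_mul, mul_diagonal, Matrix.smul_apply, Matrix.single_apply]
  split_ifs with h
  · rw [← h.1, ← h.2, smul_eq_mul]; ring
  · simp

theorem IsRep.simpleNeg_pow_weight (h : IsRep p φ) {lam : Fin n → F} {v : V}
    (hv : IsSingular φ lam v) (i : ℕ) (hi : i + 1 < n) (x : Fin n → F) (k : ℕ) :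
    φ (cartanElt x) ((φ (simpleNeg F i hi) ^ k) v) =
      (∑ l, x l * lam l + k * (x ⟨i + 1, hi⟩ - x ⟨i, by omega⟩)) •
        (φ (simpleNeg F i hi) ^ k) v := by
  induction k with
  | zero => simp [hv.weight]
  | succ k ih =>
    rw [pow_succ', Module.End.mul_apply, h.swap (cartanElt_parity x) (simpleNeg_parity i hi), ih,
      bracket_cartan_simpleNeg, koszul_zero_right, one_smul, map_smul, map_smul,
      LinearMap.smul_apply, ← add_smul]
    congr 1
    push_cast; ring

/-- The matrix form of the fact that subtracting a simple root from another positive root never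
gives a negative root or the simple root itself. The only entry below the diagonal that could arise,
at (b, a), is a difference of two diagonal entries of A. -/
theorem lt_and_ne_of_commutator_single_ne_zero {A : Matrix (Fin n) (Fin n) F}
    (hA : ∀ i j, j ≤ i → A i j = 0) {a b : Fin n} (hab : (b : ℕ) = a + 1) (h0 : A a b = 0)
    {r c : Fin n} (hne : (A * Matrix.single b a (1 : F) - Matrix.single b a (1 : F) * A : Matrix _ _ F) r c ≠ 0) :
    r < c ∧ c ≠ b := by
  have hv : ∀ i j, A i j ≠ 0 → (i : ℕ) < j ∧ ¬ (i = a ∧ j = b) := by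
    refine fun i j hij => ⟨not_le.1 fun hc => hij (hA i j hc), ?_⟩
    rintro ⟨rfl, rfl⟩
    exact hij h0
  have e1 : (A * Matrix.single b a (1 : F) : Matrix _ _ F) r c = if c = a then A r b else 0 := by
    split_ifs with hc
    · rw [hc, Matrix.mul_single_apply_same, mul_one]
    · exact Matrix.mul_single_apply_of_ne _ _ _ _ _ hc _
  have e2 : (Matrix.single b a (1 : F) * A : Matrix _ _ F) r c = if r = b then A a c else 0 := by
    split_ifs with hr
    · rw [hr, Matrix.single_mul_apply_same, one_mul]
    · exact Matrix.single_mul_apply_of_ne _ _ _ _ _ hr _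
  rw [Matrix.sub_apply, e1, e2] at hne
  rw [Fin.lt_def, ← Fin.val_ne_iff]
  simp only [Fin.ext_iff] at hv hne
  split_ifs at hne with hc hr hr
  · rw [hA _ _ (Fin.le_def.2 hr.ge), hA _ _ (Fin.le_def.2 hc.le), sub_zero] at hne
    exact absurd rfl hne
  · rw [sub_zero] at hne
    have := hv _ _ hne
    simp only [and_true] at this
    omega
  · rw [zero_sub, neg_ne_zero] at hne
    have := hv _ _ hne
    simp only [true_and] at this
    omega
  · exact absurd (sub_zero _) hne

theorem bracket_pos_simpleNeg (i : ℕ) (hi : i + 1 < n) {x : pn n F}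
    (hx : (IsEvenPos x ∧ (x : Mat n F).toBlocks₁₁ ⟨i, by omega⟩ ⟨i + 1, hi⟩ = 0) ∨ IsDegOne x) :
    (IsEvenPos (bracket x (simpleNeg F i hi)) ∧
      (bracket x (simpleNeg F i hi) : Mat n F).toBlocks₁₁ ⟨i, by omega⟩ ⟨i + 1, hi⟩ = 0) ∨
      IsDegOne (bracket x (simpleNeg F i hi)) := by
  rcases hx with ⟨hx, h0⟩ | hx
  · left
    have key : ∀ r c, _ → _ := fun r c =>
      lt_and_ne_of_commutator_single_ne_zero (r := r) (c := c) hx.2 rfl h0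
    rw [eq_evenElt hx.1, simpleNeg, bracket_evenElt, evenElt_coe, toBlocks_fromBlocks₁₁]
    refine ⟨⟨evenElt_parity _, fun a b hab => ?_⟩, ?_⟩
    · rw [evenElt_coe, toBlocks_fromBlocks₁₁]
      by_contra hne
      exact absurd (key a b hne).1 (not_lt.2 hab)
    · by_contra hne
      exact (key _ _ hne).2 rfl
  · exact .inr (bracket_degOne_even hx (simpleNeg_parity i hi))

/-- The elements of 𝔫⁺ without a component along the i-th simple root are stable under brackets with
f, so they can be moved through all the factors f to v. -/
theorem IsRep.pos_simpleNeg_pow (h : IsRep p φ) {lam : Fin n → F} {v : V}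
    (hv : IsSingular φ lam v) (i : ℕ) (hi : i + 1 < n) (k : ℕ) {x : pn n F}
    (hx : (IsEvenPos x ∧ (x : Mat n F).toBlocks₁₁ ⟨i, by omega⟩ ⟨i + 1, hi⟩ = 0) ∨ IsDegOne x) :
    φ x ((φ (simpleNeg F i hi) ^ k) v) = 0 := by
  induction k generalizing x with
  | zero => exact hv.pos x (hx.imp_left And.left)
  | succ k ih =>
    obtain ⟨j, hj⟩ := IsEvenPos.exists_parity (hx.imp_left And.left)
    rw [pow_succ', Module.End.mul_apply, h.swap hj (simpleNeg_parity i hi), ih hx,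
      ih (bracket_pos_simpleNeg i hi hx), map_zero, smul_zero, add_zero]

/-- The root vector of the i-th simple root. -/
def simplePos (F : Type*) [Field F] (i : ℕ) (hi : i + 1 < n) : pn n F :=
  evenElt (Matrix.single ⟨i, by omega⟩ ⟨i + 1, hi⟩ 1)

theorem simplePos_isEvenPos (i : ℕ) (hi : i + 1 < n) : IsEvenPos (simplePos F i hi) := by
  refine ⟨evenElt_parity _, fun a b hab => ?_⟩
  rw [simplePos, evenElt_coe, toBlocks_fromBlocks₁₁, Matrix.single_apply, if_neg]
  rintro ⟨rfl, rfl⟩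
  have : i + 1 ≤ i := hab
  omega

theorem bracket_simplePos_simpleNeg (i : ℕ) (hi : i + 1 < n) :
    bracket (simplePos F i hi) (simpleNeg F i hi) =
      cartanElt (Pi.single ⟨i, by omega⟩ 1 - Pi.single ⟨i + 1, hi⟩ 1) := by
  rw [simplePos, simpleNeg, bracket_evenElt, cartanElt_eq, single_mul_single_same,
    single_mul_single_same, mul_one, ← diagonal_single, ← diagonal_single, diagonal_sub]
  rfl

/-- The 𝔰𝔩₂ identity e f^(k+1) v = (k + 1)(λ(h) - k) f^k v with h = [e, f]. It shows which power of
f is again killed by e. -/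
theorem IsRep.simplePos_simpleNeg_pow (h : IsRep p φ) {lam : Fin n → F} {v : V}
    (hv : IsSingular φ lam v) (i : ℕ) (hi : i + 1 < n) (k : ℕ) :
    φ (simplePos F i hi) ((φ (simpleNeg F i hi) ^ (k + 1)) v) =
      ((k + 1) * (lam ⟨i, by omega⟩ - lam ⟨i + 1, hi⟩ - k)) • (φ (simpleNeg F i hi) ^ k) v := by
  have hne : (⟨i, by omega⟩ : Fin n) ≠ ⟨i + 1, hi⟩ := by simp
  have hsum : ∑ l, (Pi.single ⟨i, by omega⟩ 1 - Pi.single ⟨i + 1, hi⟩ 1 : Fin n → F) l * lam l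
      = lam ⟨i, by omega⟩ - lam ⟨i + 1, hi⟩ := by
    simp [sub_mul, Finset.sum_sub_distrib, Pi.single_apply]
  have key : ∀ k : ℕ, φ (simplePos F i hi) ((φ (simpleNeg F i hi) ^ (k + 1)) v) =
      φ (simpleNeg F i hi) (φ (simplePos F i hi) ((φ (simpleNeg F i hi) ^ k) v)) +
      (lam ⟨i, by omega⟩ - lam ⟨i + 1, hi⟩ - 2 * (k : F)) • (φ (simpleNeg F i hi) ^ k) v := by
    intro k
    rw [pow_succ', Module.End.mul_apply, h.swap (simplePos_isEvenPos i hi).1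
      (simpleNeg_parity i hi), koszul_zero_right, one_smul, bracket_simplePos_simpleNeg,
      h.simpleNeg_pow_weight hv, hsum]
    congr 2
    simp [hne, hne.symm]
    ring
  induction k with
  | zero =>
    rw [key, pow_zero, Module.End.one_apply, hv.pos _ (.inl (simplePos_isEvenPos i hi)), map_zero]
    simp
  | succ k ih =>
    rw [key, ih, map_smul, ← Module.End.mul_apply, ← pow_succ', ← add_smul]
    congr 1
    push_cast; ring

/-- The singular vector for the reflected weight. -/
theorem IsRep.isSingular_reflect (h : IsRep p φ) {lam : Fin n → F} {v : V}
    (hv : IsSingular φ lam v) (i : ℕ) (hi : i + 1 < n) {j : ℕ}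
    (hj : (j : F) = lam ⟨i, by omega⟩ - lam ⟨i + 1, hi⟩ + 1)
    (hne : (φ (simpleNeg F i hi) ^ j) v ≠ 0) :
    IsSingular φ (dotWeight (Equiv.swap ⟨i, by omega⟩ ⟨i + 1, hi⟩) lam)
      ((φ (simpleNeg F i hi) ^ j) v) where
  ne_zero := hne
  pos x hx := by
    have he : φ (simplePos F i hi) ((φ (simpleNeg F i hi) ^ j) v) = 0 := by
      -- If j = 0, the vector is v itself. If j = k + 1, the choice of j makes the factor λ(hᵢ -
      -- hᵢ₊₁) - k vanish.
      rcases j with _ | k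
      · exact hv.pos _ (.inl (simplePos_isEvenPos i hi))
      · rw [h.simplePos_simpleNeg_pow hv]
        push_cast at hj
        rw [show lam ⟨i, by omega⟩ - lam ⟨i + 1, hi⟩ - (k : F) = 0 by linear_combination -hj,
          mul_zero, zero_smul]
    rcases hx with hx | hx
    · let c := (x : Mat n F).toBlocks₁₁ ⟨i, by omega⟩ ⟨i + 1, hi⟩
      let y := x - c • simplePos F i hi
      have hy : y = evenElt ((x : Mat n F).toBlocks₁₁ -
          c • Matrix.single ⟨i, by omega⟩ ⟨i + 1, hi⟩ 1) := by
        rw [map_sub, map_smul, ← eq_evenElt hx.1]; rfl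
      have hy' : IsEvenPos y ∧ (y : Mat n F).toBlocks₁₁ ⟨i, by omega⟩ ⟨i + 1, hi⟩ = 0 := by
        rw [hy]
        refine ⟨⟨evenElt_parity _, fun a b hab => ?_⟩, ?_⟩
        · have := (simplePos_isEvenPos (F := F) i hi).2 a b hab
          rw [simplePos, evenElt_coe, toBlocks_fromBlocks₁₁] at this
          rw [evenElt_coe, toBlocks_fromBlocks₁₁, Matrix.sub_apply, Matrix.smul_apply, this,
            hx.2 a b hab, smul_zero, sub_zero]
        · rw [evenElt_coe, toBlocks_fromBlocks₁₁, Matrix.sub_apply, Matrix.smul_apply]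
          simp [c]
      have hx' : x = y + c • simplePos F i hi := by simp [y]
      rw [hx', map_add, LinearMap.add_apply, map_smul, LinearMap.smul_apply, he, smul_zero,
        h.pos_simpleNeg_pow hv i hi j (.inl hy'), add_zero]
    · exact h.pos_simpleNeg_pow hv i hi j (.inr hx)
  weight x := by
    rw [h.simpleNeg_pow_weight hv]
    congr 1
    have hne' : (⟨i, by omega⟩ : Fin n) ≠ ⟨i + 1, hi⟩ := by simp
    have hdot : dotWeight (Equiv.swap ⟨i, by omega⟩ ⟨i + 1, hi⟩) lam =
        lam + (j : F) • (Pi.single ⟨i + 1, hi⟩ 1 - Pi.single ⟨i, by omega⟩ 1) := by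
      ext l
      rw [hj]
      rcases eq_or_ne l ⟨i, by omega⟩ with rfl | h0
      · simp [dotWeight, rhoWeight, hne']
        ring
      · rcases eq_or_ne l ⟨i + 1, hi⟩ with rfl | h1
        · simp [dotWeight, rhoWeight, hne'.symm]
          ring
        · simp [dotWeight, Equiv.swap_apply_of_ne_of_ne h0 h1, h0, h1]
    rw [hdot]
    simp [mul_add, Finset.sum_add_distrib, mul_sub, Finset.sum_sub_distrib, Pi.single_apply]
    ring

end Reflection

/-! ### The Harish-Chandra map and the invariance of its values -/

section HarishChandra

universe u

variable {F : Type u} [Field F] {p : ℕ} [Fact p.Prime] [CharP F p] {n : ℕ}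

theorem isRep_ι_comp {A : Type*} [Ring A] [Algebra F A] (Φ : Ubar F p n →ₐ[F] A) :
    IsRep p (Φ.toLinearMap ∘ₗ ι F p n) where
  bracket i j x y hx hy := by
    have := congrArg Φ (ι_bracket (p := p) hx hy)
    simpa using this
  pPower x hx := by
    have := congrArg (Φ.comp (toUbar F p n)) (ιU_pPower (p := p) hx)
    rw [map_pow] at this
    exact this

variable {V : Type*} [AddCommGroup V] [Module F V] {Φ : Ubar F p n →ₐ[F] Module.End F V}
  {lam : Fin n → F} {v : V}

theorem IsSingular.apply_of_mem (hv : IsSingular (fun x => Φ (ι F p n x)) lam v) {u : Ubar F p n}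
    (hu : u ∈ leftIdealPos F n p) : Φ u v = 0 := by
  refine Submodule.span_induction ?_ ?_ ?_ ?_ hu
  · rintro _ ⟨x, hx, rfl⟩
    exact hv.pos x hx
  · simp
  · intro a b _ _ ha hb
    rw [map_add, LinearMap.add_apply, ha, hb, add_zero]
  · intro a b _ hb
    rw [smul_eq_mul, map_mul, Module.End.mul_apply, hb, map_zero]

theorem IsSingular.apply_cartanMap (hv : IsSingular (fun x => Φ (ι F p n x)) lam v)
    (hl : IsRestricted p lam) (f : Uh F p n) : Φ (cartanMap F p n f) v = ev lam hl f • v := by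
  induction f using uh_induction with
  | scalar r => rw [AlgHom.commutes, AlgHom.commutes, AlgHom.commutes]; rfl
  | gen x =>
    rw [cartanMap_ιh, ev_ιh]
    exact hv.weight x
  | mul a b ha hb =>
    rw [map_mul, map_mul, Module.End.mul_apply, hb, map_smul, ha, smul_smul, map_mul, mul_comm]
  | add a b ha hb => rw [map_add, map_add, LinearMap.add_apply, ha, hb, map_add, add_smul]

/-- The canonical map from u(𝔥) to the torus invariants of ū. -/
def cartanMapInv (F : Type*) [Field F] (p : ℕ) [Fact p.Prime] [CharP F p] (n : ℕ) :
    Uh F p n →ₗ[F] torusInv F n p :=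
  (cartanMap F p n).toLinearMap.codRestrict _ (cartanMap_mem F p n)

/-- On a singular vector of weight λ the element f acts by its value at λ, but as an element of ū𝔫⁺
it acts by 0. Singular vectors exist for all restricted λ, so all values of f vanish. -/
theorem eq_zero_of_cartanMap_mem (h2 : (2 : F) ≠ 0) (hn : 2 ≤ n) {f : Uh F p n}
    (hf : cartanMap F p n f ∈ leftIdealPos F n p) : f = 0 := by
  refine eq_zero_of_ev_eq_zero fun lam hl => ?_
  -- Only the singular vector is used, so any simple root serves; 2 ≤ n provides the one with index
  -- 0.
  obtain ⟨V, _, _, Φ, v, hv, -⟩ := exists_ubar_isSingular h2 hl 0 (by omega)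
  have h1 := hv.apply_cartanMap hl f
  rw [hv.apply_of_mem hf, eq_comm, smul_eq_zero] at h1
  exact h1.resolve_right hv.ne_zero

theorem isCompl_cartanMapInv [Infinite F] (h2 : (2 : F) ≠ 0) (hn : 2 ≤ n) :
    IsCompl (LinearMap.range (cartanMapInv F p n)) (lSub F n p) := by
  constructor
  · rw [Submodule.disjoint_def]
    rintro _ ⟨f, rfl⟩ hf
    rw [eq_zero_of_cartanMap_mem h2 hn hf, map_zero]
  · rw [codisjoint_iff, eq_top_iff]
    rintro u -
    obtain ⟨f, hf⟩ := exists_sub_cartanMap_mem u.2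
    exact Submodule.mem_sup.2 ⟨cartanMapInv F p n f, ⟨f, rfl⟩, u - cartanMapInv F p n f, hf,
      by abel⟩

theorem cartanMapInv_injective (h2 : (2 : F) ≠ 0) (hn : 2 ≤ n) :
    Function.Injective (cartanMapInv F p n) := by
  rw [injective_iff_map_eq_zero]
  intro f hf
  refine eq_zero_of_cartanMap_mem h2 hn ?_
  have : cartanMap F p n f = 0 := congrArg Subtype.val hf
  rw [this]
  exact zero_mem _

/-- The map is the projection along 𝔩 onto the complement u(𝔥). Its two properties prescribe its
values on both summands, so it is unique. -/
theorem existsUnique_isHarishChandra [Infinite F] (h2 : (2 : F) ≠ 0) (hn : 2 ≤ n) :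
    ∃! h : torusInv F n p →ₗ[F] Uh F p n, IsHarishChandra F p n h := by
  have hc := isCompl_cartanMapInv (F := F) (p := p) h2 hn
  have hi := cartanMapInv_injective (F := F) (p := p) h2 hn
  refine ⟨LinearMap.linearProjOfIsCompl _ _ hi hc,
    ⟨fun f => LinearMap.linearProjOfIsCompl_apply_left _ _ hi hc f,
      LinearMap.ker_linearProjOfIsCompl _ _ hi hc⟩, fun h hh => ?_⟩
  ext u
  obtain ⟨_, ⟨f, rfl⟩, l, hl, rfl⟩ :=
    Submodule.mem_sup.1 (show u ∈ LinearMap.range (cartanMapInv F p n) ⊔ lSub F n p by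
      rw [hc.sup_eq_top]; trivial)
  have hl' : h l = 0 := by rwa [← LinearMap.mem_ker, hh.2]
  rw [map_add, map_add, LinearMap.linearProjOfIsCompl_apply_left _ _ hi hc,
    LinearMap.linearProjOfIsCompl_apply_right' _ _ hi hc l hl, hl']
  exact congrArg (· + 0) (hh.1 f)

/-- The difference between u and h(u) lies in ū𝔫⁺ and so kills v; hence every torus invariant acts
on v by the value of its Harish-Chandra image. -/
theorem IsHarishChandra.apply_singular {h : torusInv F n p →ₗ[F] Uh F p n}
    (hh : IsHarishChandra F p n h) (hv : IsSingular (fun x => Φ (ι F p n x)) lam v)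
    (hl : IsRestricted p lam) (u : torusInv F n p) : Φ u v = ev lam hl (h u) • v := by
  have h1 : u - cartanMapInv F p n (h u) ∈ lSub F n p := by
    rw [← hh.2, LinearMap.mem_ker, map_sub, sub_eq_zero]
    exact (hh.1 (h u)).symm
  have h2 := hv.apply_of_mem h1
  rw [← hv.apply_cartanMap hl, ← sub_eq_zero, ← LinearMap.sub_apply, ← map_sub]
  exact h2

/-- Since z commutes with f, its scalars on the singular vectors v and f^j v coincide. These are the
values of h(z) at λ and at sᵢ · λ. -/
theorem IsHarishChandra.apply_mem_dotInv [Infinite F] (h2 : (2 : F) ≠ 0)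
    {h : torusInv F n p →ₗ[F] Uh F p n} (hh : IsHarishChandra F p n h) {z : torusInv F n p}
    (hz : ∀ g : GL (Fin n) F, act p g (z : Ubar F p n) = z) : h z ∈ dotInv F p n := by
  refine mem_dotInv fun i hi lam hl => ?_
  -- The representative below p is essential: f^j v is known to be nonzero only for j < p.
  obtain ⟨j, hjp, hj⟩ := exists_natCast_eq (p := p)
    (c := lam ⟨i, by omega⟩ - lam ⟨i + 1, hi⟩ + 1)
    (by rw [add_pow_char, sub_pow_char, hl, hl, one_pow])
  obtain ⟨V, _, _, Φ, v, hv, hne⟩ := exists_ubar_isSingular h2 hl i hi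
  have hs := (isRep_ι_comp Φ).isSingular_reflect hv i hi hj (hne j hjp)
  have hs' : IsSingular (fun x => Φ (ι F p n x))
    (dotWeight (Equiv.swap ⟨i, by omega⟩ ⟨i + 1, hi⟩) lam)
      ((Φ (ι F p n (simpleNeg F i hi)) ^ j) v) := hs
  have hcomm : Commute (Φ z) (Φ (ι F p n (simpleNeg F i hi))) := by
    have := congrArg Φ (commute_of_act_eq hz
      (E := Matrix.single ⟨i + 1, hi⟩ ⟨i, by omega⟩ (1 : F)) (by
        rw [Matrix.single_mul_single_of_ne]; simp))
    rw [map_mul, map_mul] at this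
    exact this.symm
  have h3 := hh.apply_singular hs' (dotWeight_isRestricted _ hl) z
  have h4 := LinearMap.congr_fun (hcomm.pow_right j).eq v
  rw [Module.End.mul_apply, Module.End.mul_apply, hh.apply_singular hv hl, map_smul, h3,
    ← sub_eq_zero, ← sub_smul, smul_eq_zero, sub_eq_zero] at h4
  exact h4.resolve_right (hne j hjp)

end HarishChandra

end Periplectic

end

theorem lemma3p7 (F : Type*) [Field F] [IsAlgClosed F] (p : ℕ) [Fact p.Prime] [CharP F p]
    (hp : 3 < p) (n : ℕ) (hn : 2 ≤ n) :
    (∃! h : Periplectic.torusInv F n p →ₗ[F] Periplectic.Uh F p n,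
      Periplectic.IsHarishChandra F p n h) ∧
    ∀ h : Periplectic.torusInv F n p →ₗ[F] Periplectic.Uh F p n,
      Periplectic.IsHarishChandra F p n h →
      h '' {z | (z : Periplectic.Ubar F p n) ∈ Periplectic.centralZ F n p}
        ⊆ Periplectic.dotInv F p n := by
  have h2 : (2 : F) ≠ 0 := by
    intro h0
    have : ((2 : ℕ) : F) = 0 := by exact_mod_cast h0
    rw [CharP.cast_eq_zero_iff F p] at this
    have := Nat.le_of_dvd (by norm_num) this
    omega
  have : Infinite F := IsAlgClosed.instInfinite
  refine ⟨Periplectic.existsUnique_isHarishChandra h2 hn, ?_⟩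
  rintro h hh _ ⟨z, hz, rfl⟩
  exact hh.apply_mem_dotInv h2 hz.2.1
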